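/- Let $\mathcal A$ be a finite set, $\mathcal H_E$ a finite-dimensional Hilbert space, $P$ a probability distribution on $\mathcal A$ and, for each $a\in\mathcal A$, let $\rho_a$ be a density matrix on $\mathcal H_E$. Put $\rho=\sum_a P(a)\,|a\rangle\langle a|\otimes\rho_a$ and $\rho^E=\sum_a P(a)\rho_a$. Define $$H(A|E|\rho)=-\operatorname{Tr}\rho\log\rho+\operatorname{Tr}\rho^E\log\rho^E,\qquad H_{1+s}(A|E|\rho)=-\frac1s\log\operatorname{Tr}\rho^{1+s}\,\bigl(I_A\otimes(\rho^E)^{-s}\bigr),$$ where logarithms and negative powers are taken on the support. For a function $f:\mathcal A\to\{1,\dots,M\}$ let $\rho^{f(A),E}=\sum_{i}|i\rangle\langle i|\otimes\sum_{a:f(a)=i}P(a)\rho_a$, let $\rho_{\rm mix}=I/M$ on $\mathbb C^M$, and put $$I'(f(A):E|\rho)=D\bigl(\rho^{f(A),E}\,\big\|\,\rho_{\rm mix}\otimes\rho^E\bigr),\qquad d_1'(f(A):E|\rho)=\bigl\|\rho^{f(A),E}-\rho_{\rm mix}\otimes\rho^E\bigr\|_1,$$ where $D(\rho\|\sigma)=\operatorname{Tr}\rho(\log\rho-\log\sigma)$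 and $\|\cdot\|_1$ is the trace norm. In the i.i.d. setting, with $\rho^{\otimes n}$ regarded as a state of a random number in $\mathcal A^n$ and of $\mathcal H_E^{\otimes n}$, define for a real key rate $R$ $$e_I(\rho|R)=\sup_{\{(f_n,M_n)\}}\ \liminf_{n\to\infty}\frac{-\log I'(f_n(A):E|\rho^{\otimes n})}{n},\qquad e_d(\rho|R)=\sup_{\{(f_n,M_n)\}}\ \liminf_{n\to\infty}\frac{-\log d_1'(f_n(A):E|\rho^{\otimes n})}{n}$$ as elements of $[-\infty,\infty]$ (with $-\log 0=\infty$), where the suprema run over all sequences of integers $M_n\ge1$ and functions $f_n:\mathcal A^n\to\{1,\dots,M_n\}$ such that $\lim_{n\to\infty}\frac{\log M_n}{n}$ exists and is at least $R$. Then the maximum $$e_H(\rho|R):=\max_{0\le s\le1}s\,\bigl(H_{1+s}(A|E|\rho)-R\bigr)$$ exists (the expression being $0$ at $s=0$), and $$e_I(\rho|R)\ \ge\ e_H(\rho|R),\qquad e_d(\rho|R)\ \ge\ \tfrac12\,e_H(\rho|R).$$ Moreover, if $R<H(A|E|\rho)$, then $e_H(\rho|R)>0$, and hence $e_I(\rho|R)>0$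 and $e_d(\rho|R)>0$. -/

import Mathlib

open Set Filter Topology
open scoped Kronecker ComplexOrder

noncomputable section

namespace PrivacyAmp

/-- A density matrix on the finite-dimensional Hilbert space with orthonormal basis `d`. -/
def IsDensity {d : Type*} [Fintype d] (τ : Matrix d d ℂ) : Prop :=
  τ.PosSemidef ∧ τ.trace = 1

/-- The state `∑ a, P(a) |a⟩⟨a| ⊗ τ_a` of the classical random number `A` and Eve's system. -/
def cqState {A d : Type*} [Fintype A] [DecidableEq A] (P : A → ℝ) (τ : A → Matrix d d ℂ) :
    Matrix (A × d) (A × d) ℂ :=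
  ∑ a, (P a : ℂ) • (Matrix.single a a (1 : ℂ) ⊗ₖ τ a)

/-- The reduced state on the second system: `ρ^E = Tr_A ρ`. -/
def traceA {A d : Type*} [Fintype A] (ρ : Matrix (A × d) (A × d) ℂ) : Matrix d d ℂ :=
  Matrix.of fun x y => ∑ a, ρ (a, x) (a, y)

/-- The logarithm of a positive semidefinite matrix by functional calculus, `log` acting on the
nonzero eigenvalues only (`Real.log 0 = 0`, so that `0 log 0 = 0`). -/
def matLog {n : Type*} [Fintype n] [DecidableEq n] (X : Matrix n n ℂ) : Matrix n n ℂ :=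
  cfc Real.log X

/-- The real power of a positive semidefinite matrix by functional calculus. A power with a
nonzero exponent (negative ones included) acts on the support only (`0 ^ t = 0` for `t ≠ 0`). -/
def matPow {n : Type*} [Fintype n] [DecidableEq n] (X : Matrix n n ℂ) (t : ℝ) : Matrix n n ℂ :=
  cfc (fun x : ℝ => x ^ t) X

/-- The von Neumann entropy `H(ρ) = -Tr ρ log ρ`. -/
def vonNeumannEntropy {n : Type*} [Fintype n] [DecidableEq n] (ρ : Matrix n n ℂ) : ℝ :=
  -(ρ * matLog ρ).trace.re

/-- The quantum relative entropy `D(ρ‖σ) = Tr ρ (log ρ - log σ)` for states with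
`supp ρ ⊆ supp σ`. -/
def relEntropy {n : Type*} [Fintype n] [DecidableEq n] (ρ σ : Matrix n n ℂ) : ℝ :=
  (ρ * (matLog ρ - matLog σ)).trace.re

/-- The trace norm `‖X‖₁ = Tr √(X† X)`. -/
def traceNorm {n : Type*} [Fintype n] [DecidableEq n] (X : Matrix n n ℂ) : ℝ :=
  (cfc Real.sqrt (X.conjTranspose * X)).trace.re

section Quantities

variable {A d : Type*} [Fintype A] [DecidableEq A] [Fintype d] [DecidableEq d]

/-- The conditional entropy `H(A|E|ρ) = H(A,E|ρ) - H(E|ρ)`. -/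
def condEntropy (ρ : Matrix (A × d) (A × d) ℂ) : ℝ :=
  vonNeumannEntropy ρ - vonNeumannEntropy (traceA ρ)

/-- The conditional Rényi entropy
`H_{1+s}(A|E|ρ) = -(1/s) log Tr (ρ^{1+s} (I_A ⊗ (ρ^E)^{-s}))`, as a function of `s`. -/
def condRenyi (s : ℝ) (ρ : Matrix (A × d) (A × d) ℂ) : ℝ :=
  (-1 / s) *
    Real.log (matPow ρ (1 + s) * ((1 : Matrix A A ℂ) ⊗ₖ matPow (traceA ρ) (-s))).trace.re

/-- The completely mixed state `ρ_mix^A` on the classical system. -/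
def mixedState (A : Type*) [Fintype A] [DecidableEq A] : Matrix A A ℂ :=
  ((Fintype.card A : ℂ)⁻¹) • (1 : Matrix A A ℂ)

/-- The modified mutual information `I'(A:E|ρ) = D(ρ ‖ ρ_mix^A ⊗ ρ^E)`. For a state `ρ` that is
classical on `A` the support of `ρ` lies in that of `ρ_mix^A ⊗ ρ^E`. -/
def modMutualInfo (ρ : Matrix (A × d) (A × d) ℂ) : ℝ :=
  relEntropy ρ (mixedState A ⊗ₖ traceA ρ)

/-- The security criterion `d₁'(A:E|ρ) = ‖ρ - ρ_mix^A ⊗ ρ^E‖₁`. -/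
def modTraceDist (ρ : Matrix (A × d) (A × d) ℂ) : ℝ :=
  traceNorm (ρ - mixedState A ⊗ₖ traceA ρ)

/-- The state `∑ b, |b⟩⟨b| ⊗ ∑_{a : f a = b} ρ_a` of `f(A)` and Eve's system, where `ρ_a` is the
block `⟨a|ρ|a⟩` of `ρ`. -/
def hashState {B : Type*} [DecidableEq B] (f : A → B) (ρ : Matrix (A × d) (A × d) ℂ) :
    Matrix (B × d) (B × d) ℂ :=
  Matrix.of fun x y =>
    if x.1 = y.1 then ∑ a with f a = x.1, ρ (a, x.2) (a, y.2) else 0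

/-- The `n`-fold tensor power `ρ^{⊗n}`, as a state of the random number in `A^n` and of Eve's
system with basis `d^n`. -/
def iidState (ρ : Matrix (A × d) (A × d) ℂ) (n : ℕ) :
    Matrix ((Fin n → A) × (Fin n → d)) ((Fin n → A) × (Fin n → d)) ℂ :=
  Matrix.of fun x y => ∏ i, ρ (x.1 i, x.2 i) (y.1 i, y.2 i)

/-- The exponential decreasing rate `liminf (-log c_n) / n` of a sequence of nonnegative reals,
in `[-∞, ∞]`, with `-log 0 = ∞`. -/
def decayRate (c : ℕ → ℝ) : EReal :=
  liminf (fun n : ℕ => -ENNReal.log (ENNReal.ofReal (c n)) / (n : EReal)) atTop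

/-- The optimal exponent at key rate `R` of the modified mutual information: the supremum of the
exponential decreasing rates of `I'(f_n(A):E|ρ^{⊗n})` over all sequences of functions
`f_n : A^n → {1, …, M_n}` with `lim (log M_n) / n ≥ R`. -/
def exponentI (ρ : Matrix (A × d) (A × d) ℂ) (R : ℝ) : EReal :=
  sSup {e : EReal | ∃ (M : ℕ → ℕ) (f : (n : ℕ) → (Fin n → A) → Fin (M n)) (r : ℝ),
    Tendsto (fun n : ℕ => Real.log (M n) / n) atTop (𝓝 r) ∧ R ≤ r ∧
    e = decayRate fun n => modMutualInfo (hashState (f n) (iidState ρ n))}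

/-- The optimal exponent at key rate `R` of the trace norm criterion `d₁'`, as for `I'`. -/
def exponentD (ρ : Matrix (A × d) (A × d) ℂ) (R : ℝ) : EReal :=
  sSup {e : EReal | ∃ (M : ℕ → ℕ) (f : (n : ℕ) → (Fin n → A) → Fin (M n)) (r : ℝ),
    Tendsto (fun n : ℕ => Real.log (M n) / n) atTop (𝓝 r) ∧ R ≤ r ∧
    e = decayRate fun n => modTraceDist (hashState (f n) (iidState ρ n))}

/-- `e_H(ρ|R) = max_{0 ≤ s ≤ 1} s (H_{1+s}(A|E|ρ) - R)`; the expression is `0` at `s = 0`. -/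
def exponentH (ρ : Matrix (A × d) (A × d) ℂ) (R : ℝ) : ℝ :=
  sSup ((fun s : ℝ => s * (condRenyi s ρ - R)) '' Icc 0 1)

end Quantities

end PrivacyAmp

end

noncomputable section

namespace PrivacyAmp

open Matrix

set_option linter.unusedSectionVars false

/-! Write `ρ = ∑ |a⟩⟨a| ⊗ ω_a` and `σ = ρ^E = ∑ ω_a`. The hash is a uniformly random function into
`M` values. In mean over `f`, the bin containing `a` is `ω_a + (σ - ω_a)/M`, so operator concavity
and monotonicity of the logarithm bound the mean of `I'` by `∑ Tr ω_a (log (ω_a + σ/M) - log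
(σ/M))`, up to a regularization `ε` that makes every argument of a logarithm positive definite.

The matrices `ω_a` and `σ` need not commute. Pinching `ω_a` to the level sets of the eigenvalues of
`σ` makes them commute, at the price of a factor `v`, the number of level sets: `ω_a ≤ v · pinch
ω_a`. What remains is a scalar estimate: `log (1 + x) ≤ x^s / s` turns the difference of logarithms
into `(vM)^s / s · Tr ω_a^{1+s} σ^{-s}`, and Jensen's inequality removes the pinching from the power
(`trace_mul_log_le`, `exists_hash_modMutualInfo_le`).

For `n` copies, the eigenvalue of `σ^{⊗n}` at a sequence depends only on its type, so `v =
(n+1)^{dim}` costs nothing in the exponent, and the Rényi sum is multiplicative (`exists_hash_iid`,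
`renyiSum_iid`). This gives the exponent `s (H_{1+s} - R)` for `I'`. The Pinsker-type bound
`traceNorm_sub_sq_le` gives half of it for `d₁'`.

In eigenbases of the `ω_a` and of `σ`, the Rényi sum is a moment generating function `∑ w_i e^{s
x_i}` with mean `∑ w_i x_i = -H(A|E)` (`exists_renyiSum_eq`). Hence `s (H_{1+s} - R)` is continuous
on `[0,1]` and has derivative `H(A|E) - R` at `0`, which yields both the maximum and its positivity.
-/

/-- The matrix `U diag(r) U†`. -/
def spec {n : Type*} [Fintype n] [DecidableEq n] (U : Matrix n n ℂ) (r : n → ℝ) : Matrix n n ℂ :=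
  U * Matrix.diagonal (fun i => (r i : ℂ)) * Uᴴ

/-! ### Functional calculus and traces in explicit eigenbases -/

section Spec

variable {n : Type*} [Fintype n] [DecidableEq n]

lemma spec_isHermitian (U : Matrix n n ℂ) (r : n → ℝ) : (spec U r).IsHermitian := by
  unfold spec Matrix.IsHermitian
  simp only [conjTranspose_mul, conjTranspose_conjTranspose, diagonal_conjTranspose, mul_assoc]
  congr 3
  ext i
  simp

lemma spec_add (U : Matrix n n ℂ) (r t : n → ℝ) :
    spec U r + spec U t = spec U (fun i => r i + t i) := by
  simp only [spec, ← add_mul, ← mul_add, diagonal_add]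
  simp

lemma spec_smul (U : Matrix n n ℂ) (c : ℝ) (r : n → ℝ) :
    (c : ℂ) • spec U r = spec U (fun i => c * r i) := by
  have : Matrix.diagonal (fun i => ((c * r i : ℝ) : ℂ)) = (c : ℂ) • Matrix.diagonal (fun i => (r i : ℂ)) := by
    ext i j; by_cases h : i = j <;> simp [h]
  simp only [spec, this, Matrix.mul_smul, Matrix.smul_mul]

lemma spec_sub (U : Matrix n n ℂ) (r t : n → ℝ) :
    spec U r - spec U t = spec U (fun i => r i - t i) := by
  rw [sub_eq_iff_eq_add, spec_add]; simp

variable {U : Matrix n n ℂ}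

lemma spec_const (hU : U ∈ unitaryGroup n ℂ) (c : ℝ) :
    spec U (fun _ => c) = (c : ℂ) • 1 := by
  have : Matrix.diagonal (fun _ : n => (c : ℂ)) = (c : ℂ) • 1 := by
    rw [smul_one_eq_diagonal]
  rw [spec, this, Matrix.mul_smul, mul_one, Matrix.smul_mul, ← star_eq_conjTranspose, mem_unitaryGroup_iff.1 hU]

lemma spec_mul_spec (hU : U ∈ unitaryGroup n ℂ) (r t : n → ℝ) :
    spec U r * spec U t = spec U (fun i => r i * t i) := by
  have h : Uᴴ * U = 1 := mem_unitaryGroup_iff'.1 hU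
  unfold spec
  calc _ = U * Matrix.diagonal (fun i => (r i : ℂ)) * (Uᴴ * U) * Matrix.diagonal (fun i => (t i : ℂ)) * Uᴴ := by
        simp only [mul_assoc]
    _ = _ := by simp [h, mul_assoc, diagonal_mul_diagonal]

lemma spec_pow (hU : U ∈ unitaryGroup n ℂ) (r : n → ℝ) (k : ℕ) :
    spec U r ^ k = spec U (fun i => r i ^ k) := by
  induction k with
  | zero => simpa using (spec_const hU 1).symm
  | succ k ih => simp_rw [pow_succ, ih, spec_mul_spec hU]

lemma aeval_spec (hU : U ∈ unitaryGroup n ℂ) (r : n → ℝ) (p : Polynomial ℝ) :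
    Polynomial.aeval (spec U r) p = spec U (fun i => p.eval (r i)) := by
  induction p using Polynomial.induction_on' with
  | add p q hp hq => simp [hp, hq, spec_add]
  | monomial k c =>
    rw [Polynomial.aeval_monomial, spec_pow hU, ← Algebra.smul_def]
    simp only [Polynomial.eval_monomial]
    rw [← spec_smul]
    ext i j; simp

lemma spectrum_spec_subset (hU : U ∈ unitaryGroup n ℂ) (r : n → ℝ) :
    spectrum ℝ (spec U r) ⊆ Set.range r := by
  intro x hx
  by_contra hne
  refine hx (spectrum.mem_resolventSet_iff.2 ?_)
  have h : algebraMap ℝ (Matrix n n ℂ) x = spec U (fun _ => x) := by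
    rw [spec_const hU, Algebra.algebraMap_eq_smul_one]; ext i j; simp
  rw [h, spec_sub]
  have hne' : ∀ i, x - r i ≠ 0 := fun i hi => hne ⟨i, (sub_eq_zero.1 hi).symm⟩
  refine IsUnit.of_mul_eq_one (spec U (fun i => (x - r i)⁻¹)) ?_
  rw [spec_mul_spec hU]
  simp [hne', spec_const hU]

/-- The spectrum is finite, so `f` agrees on it with its Lagrange interpolant, and for polynomials
the calculus is plain evaluation. No regularity of `f` is needed, which admits `log` and negative
powers with their values at `0`. -/
lemma cfc_spec (hU : U ∈ unitaryGroup n ℂ) (r : n → ℝ) (f : ℝ → ℝ) :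
    cfc f (spec U r) = spec U (fun i => f (r i)) := by
  set p := Lagrange.interpolate (Finset.univ.image r) id f with hp
  have hev : ∀ i, p.eval (r i) = f (r i) := fun i =>
    Lagrange.eval_interpolate_at_node f (Set.injOn_id _) (Finset.mem_image_of_mem r (Finset.mem_univ i))
  have h1 : cfc f (spec U r) = cfc p.eval (spec U r) := by
    refine cfc_congr fun x hx => ?_
    obtain ⟨i, rfl⟩ := spectrum_spec_subset hU r hx
    exact (hev i).symm
  rw [h1, cfc_polynomial p _ (spec_isHermitian U r).isSelfAdjoint, aeval_spec hU]
  simp_rw [hev]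

lemma exists_spec {X : Matrix n n ℂ} (hX : X.IsHermitian) :
    ∃ U ∈ unitaryGroup n ℂ, ∃ r : n → ℝ, X = spec U r :=
  ⟨hX.eigenvectorUnitary, hX.eigenvectorUnitary.2, hX.eigenvalues, hX.spectral_theorem⟩

lemma exists_spec_nonneg {X : Matrix n n ℂ} (hX : X.PosSemidef) :
    ∃ U ∈ unitaryGroup n ℂ, ∃ r : n → ℝ, (∀ i, 0 ≤ r i) ∧ X = spec U r :=
  ⟨hX.1.eigenvectorUnitary, hX.1.eigenvectorUnitary.2, hX.1.eigenvalues,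
    hX.eigenvalues_nonneg, hX.1.spectral_theorem⟩

lemma spec_posSemidef (U : Matrix n n ℂ) {r : n → ℝ} (hr : ∀ i, 0 ≤ r i) :
    (spec U r).PosSemidef := by
  refine PosSemidef.mul_mul_conjTranspose_same (PosSemidef.diagonal (Pi.le_def.2 fun i => ?_)) U
  simpa using hr i

lemma spec_posDef (hU : U ∈ unitaryGroup n ℂ) {r : n → ℝ} (hr : ∀ i, 0 < r i) :
    (spec U r).PosDef := by
  rw [(spec_posSemidef U fun i => (hr i).le).posDef_iff_isUnit]
  refine IsUnit.of_mul_eq_one (spec U (fun i => (r i)⁻¹)) ?_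
  rw [spec_mul_spec hU]
  simp [(hr _).ne', spec_const hU]

/-- The real diagonal of `X` in the basis of the columns of `V`. -/
def diagIn (V X : Matrix n n ℂ) (j : n) : ℝ := ((Vᴴ * X * V) j j).re

/-- The squared overlaps of the bases of columns of `U` and `V`. -/
def overlap (U V : Matrix n n ℂ) (i j : n) : ℝ := Complex.normSq ((Uᴴ * V) i j)

lemma overlap_nonneg (U V : Matrix n n ℂ) (i j : n) : 0 ≤ overlap U V i j := Complex.normSq_nonneg _

lemma diag_of_isHermitian {X : Matrix n n ℂ} (hX : X.IsHermitian) (V : Matrix n n ℂ) (j : n) :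
    (Vᴴ * X * V) j j = (diagIn V X j : ℂ) := by
  have h : (Vᴴ * X * V).IsHermitian := isHermitian_conjTranspose_mul_mul V hX
  exact (Complex.conj_eq_iff_re.1 (h.apply j j)).symm

lemma trace_mul_spec {X : Matrix n n ℂ} (hX : X.IsHermitian) (V : Matrix n n ℂ) (t : n → ℝ) :
    (X * spec V t).trace = ((∑ j, diagIn V X j * t j : ℝ) : ℂ) := by
  have : (X * spec V t).trace = (Vᴴ * X * V * Matrix.diagonal (fun i => (t i : ℂ))).trace := by
    rw [spec, ← mul_assoc, ← mul_assoc, trace_mul_comm]; simp only [mul_assoc]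
  rw [this, trace]
  simp [mul_diagonal, diag_of_isHermitian hX]

lemma diagIn_spec (U V : Matrix n n ℂ) (r : n → ℝ) (j : n) :
    diagIn V (spec U r) j = ∑ i, overlap U V i j * r i := by
  have h : Vᴴ * spec U r * V = (Uᴴ * V)ᴴ * (Matrix.diagonal (fun i => (r i : ℂ)) * (Uᴴ * V)) := by
    simp only [spec, conjTranspose_mul, conjTranspose_conjTranspose, mul_assoc]
  rw [diagIn, h, mul_apply]
  simp only [diagonal_mul, conjTranspose_apply, Complex.re_sum, overlap]
  refine Finset.sum_congr rfl fun i _ => ?_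
  rw [mul_left_comm, Complex.star_def, ← Complex.normSq_eq_conj_mul_self, ← Complex.ofReal_mul,
    Complex.ofReal_re, mul_comm]

lemma diagIn_sub (V X Y : Matrix n n ℂ) (j : n) :
    diagIn V (X - Y) j = diagIn V X j - diagIn V Y j := by
  simp [diagIn, mul_sub, sub_mul]

lemma diagIn_smul (V X : Matrix n n ℂ) (c : ℝ) (j : n) :
    diagIn V ((c : ℂ) • X) j = c * diagIn V X j := by
  simp [diagIn]

lemma diagIn_nonneg {X : Matrix n n ℂ} (hX : X.PosSemidef) (V : Matrix n n ℂ) (j : n) :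
    0 ≤ diagIn V X j :=
  (Complex.le_def.1 (hX.conjTranspose_mul_mul_same V).diag_nonneg).1

lemma diagIn_spec_self (hU : U ∈ unitaryGroup n ℂ) (r : n → ℝ) (j : n) :
    diagIn U (spec U r) j = r j := by
  have h : Uᴴ * U = 1 := mem_unitaryGroup_iff'.1 hU
  rw [diagIn_spec, Finset.sum_eq_single j]
  · simp [overlap, h]
  · intro i _ hi; simp [overlap, h, hi]
  · simp

lemma sum_overlap_left (hU : U ∈ unitaryGroup n ℂ) {V : Matrix n n ℂ} (hV : V ∈ unitaryGroup n ℂ)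
    (j : n) : ∑ i, overlap U V i j = 1 := by
  have := diagIn_spec U V (fun _ => 1) j
  rw [spec_const hU, diagIn] at this
  have h : Vᴴ * V = 1 := mem_unitaryGroup_iff'.1 hV
  simpa [h] using this.symm

lemma overlap_comm (U V : Matrix n n ℂ) (i j : n) : overlap U V i j = overlap V U j i := by
  have : Uᴴ * V = (Vᴴ * U)ᴴ := by simp
  rw [overlap, overlap, this, conjTranspose_apply, Complex.star_def, Complex.normSq_conj]

lemma sum_overlap_right (hU : U ∈ unitaryGroup n ℂ) {V : Matrix n n ℂ} (hV : V ∈ unitaryGroup n ℂ)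
    (i : n) : ∑ j, overlap U V i j = 1 := by
  simp_rw [overlap_comm U V]; exact sum_overlap_left hV hU i

lemma trace_spec_mul_spec (U V : Matrix n n ℂ) (r t : n → ℝ) :
    (spec U r * spec V t).trace = ((∑ j, ∑ i, overlap U V i j * r i * t j : ℝ) : ℂ) := by
  rw [trace_mul_spec (spec_isHermitian U r)]
  simp_rw [diagIn_spec, Finset.sum_mul]

lemma trace_spec (hU : U ∈ unitaryGroup n ℂ) (r : n → ℝ) :
    (spec U r).trace = ((∑ i, r i : ℝ) : ℂ) := by
  rw [spec, trace_mul_comm, ← mul_assoc, show Uᴴ * U = 1 from mem_unitaryGroup_iff'.1 hU]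
  simp [trace]

/-- The support condition `supp X ⊆ supp σ`, in terms of overlaps of eigenbases. -/
lemma overlap_mul_eq_zero {V : Matrix n n ℂ} (hV : V ∈ unitaryGroup n ℂ)
    {r t : n → ℝ} (hr : ∀ i, 0 ≤ r i) {C : ℝ}
    (hC : ((C : ℂ) • spec V t - spec U r).PosSemidef) (i j : n) (hj : t j = 0) :
    overlap U V i j * r i = 0 := by
  have h := diagIn_nonneg hC V j
  rw [diagIn_sub, diagIn_smul, diagIn_spec_self hV, hj, mul_zero, diagIn_spec] at h
  have h0 : ∀ i ∈ Finset.univ, 0 ≤ overlap U V i j * r i := fun i _ =>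
    mul_nonneg (overlap_nonneg ..) (hr i)
  exact (Finset.sum_eq_zero_iff_of_nonneg h0).1
    (le_antisymm (by linarith) (Finset.sum_nonneg h0)) i (Finset.mem_univ i)

end Spec

/-! ### Block diagonal matrices: states classical on the first system -/

/-- The block diagonal matrix `∑ a, |a⟩⟨a| ⊗ ω_a`. -/
def blk {α n : Type*} [DecidableEq α] (ω : α → Matrix n n ℂ) : Matrix (α × n) (α × n) ℂ :=
  Matrix.of fun x y => if x.1 = y.1 then ω x.1 x.2 y.2 else 0

section Blocks

variable {α n : Type*} [Fintype α] [DecidableEq α] [Fintype n] [DecidableEq n]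

lemma blk_mul (ω κ : α → Matrix n n ℂ) : blk ω * blk κ = blk fun a => ω a * κ a := by
  ext ⟨a, x⟩ ⟨b, y⟩
  simp only [blk, mul_apply, of_apply, Fintype.sum_prod_type]
  rw [Finset.sum_eq_single a]
  · by_cases h : a = b <;> simp [h]
  · intro c _ hc; simp [Ne.symm hc]
  · simp

lemma blk_sub (ω κ : α → Matrix n n ℂ) : blk ω - blk κ = blk fun a => ω a - κ a := by
  ext ⟨a, x⟩ ⟨b, y⟩
  by_cases h : a = b <;> simp [blk, h]

lemma blk_smul (c : ℂ) (ω : α → Matrix n n ℂ) : c • blk ω = blk fun a => c • ω a := by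
  ext ⟨a, x⟩ ⟨b, y⟩
  by_cases h : a = b <;> simp [blk, h]

lemma blk_one : blk (fun _ : α => (1 : Matrix n n ℂ)) = 1 := by
  ext ⟨a, x⟩ ⟨b, y⟩
  by_cases h : a = b <;> simp [blk, h, one_apply]

lemma blk_conjTranspose (ω : α → Matrix n n ℂ) : (blk ω)ᴴ = blk fun a => (ω a)ᴴ := by
  ext ⟨a, x⟩ ⟨b, y⟩
  by_cases h : a = b
  · subst h; simp [blk]
  · simp [blk, h, Ne.symm h]

lemma blk_trace (ω : α → Matrix n n ℂ) : (blk ω).trace = ∑ a, (ω a).trace := by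
  simp [blk, trace, Fintype.sum_prod_type]

lemma blk_unitary {U : α → Matrix n n ℂ} (hU : ∀ a, U a ∈ unitaryGroup n ℂ) :
    blk U ∈ unitaryGroup (α × n) ℂ := by
  rw [mem_unitaryGroup_iff, star_eq_conjTranspose, blk_conjTranspose, blk_mul]
  simp_rw [← star_eq_conjTranspose, fun a => mem_unitaryGroup_iff.1 (hU a), blk_one]

lemma blk_spec (U : α → Matrix n n ℂ) (r : α → n → ℝ) :
    blk (fun a => spec (U a) (r a)) = spec (blk U) fun x => r x.1 x.2 := by
  have : (Matrix.diagonal fun x : α × n => (r x.1 x.2 : ℂ)) =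
      blk fun a => Matrix.diagonal fun i => (r a i : ℂ) := by
    ext ⟨a, x⟩ ⟨b, y⟩
    by_cases h : a = b <;> simp [blk, h, diagonal_apply]
  rw [spec, this, blk_conjTranspose, blk_mul, blk_mul]
  rfl

lemma blk_posSemidef {ω : α → Matrix n n ℂ} (hω : ∀ a, (ω a).PosSemidef) :
    (blk ω).PosSemidef := by
  choose U hU r hr h using fun a => exists_spec_nonneg (hω a)
  simp_rw [funext h, blk_spec]
  exact spec_posSemidef _ fun x => hr x.1 x.2

lemma cfc_blk {ω : α → Matrix n n ℂ} (hω : ∀ a, (ω a).IsHermitian) (f : ℝ → ℝ) :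
    cfc f (blk ω) = blk fun a => cfc f (ω a) := by
  choose U hU r h using fun a => exists_spec (hω a)
  have h2 : (fun a => cfc f (ω a)) = fun a => spec (U a) fun i => f (r a i) := by
    funext a; rw [h a, cfc_spec (hU a)]
  rw [h2, blk_spec, funext h, blk_spec, cfc_spec (blk_unitary hU)]

lemma matLog_blk {ω : α → Matrix n n ℂ} (hω : ∀ a, (ω a).IsHermitian) :
    matLog (blk ω) = blk fun a => matLog (ω a) := cfc_blk hω _

lemma matPow_blk {ω : α → Matrix n n ℂ} (hω : ∀ a, (ω a).IsHermitian) (s : ℝ) :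
    matPow (blk ω) s = blk fun a => matPow (ω a) s := cfc_blk hω _

lemma matLog_spec {U : Matrix n n ℂ} (hU : U ∈ unitaryGroup n ℂ) (r : n → ℝ) :
    matLog (spec U r) = spec U fun i => Real.log (r i) := cfc_spec hU r _

lemma matPow_spec {U : Matrix n n ℂ} (hU : U ∈ unitaryGroup n ℂ) (r : n → ℝ) (s : ℝ) :
    matPow (spec U r) s = spec U fun i => r i ^ s := cfc_spec hU r _

lemma traceA_blk (ω : α → Matrix n n ℂ) : traceA (blk ω) = ∑ a, ω a := by
  ext x y
  simp [traceA, blk, Matrix.sum_apply]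

lemma one_kronecker_eq_blk (X : Matrix n n ℂ) : (1 : Matrix α α ℂ) ⊗ₖ X = blk fun _ => X := by
  ext ⟨a, x⟩ ⟨b, y⟩
  simp [blk, one_apply]

lemma mixedState_kronecker (X : Matrix n n ℂ) :
    mixedState α ⊗ₖ X = blk fun _ => ((Fintype.card α : ℂ)⁻¹) • X := by
  rw [mixedState, smul_kronecker, one_kronecker_eq_blk, blk_smul]

lemma cqState_eq_blk (P : α → ℝ) (τ : α → Matrix n n ℂ) :
    cqState P τ = blk fun a => (P a : ℂ) • τ a := by
  ext ⟨a, x⟩ ⟨b, y⟩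
  simp only [cqState, Matrix.sum_apply, Matrix.smul_apply, kronecker_apply, single_apply, blk, of_apply,
    smul_eq_mul]
  by_cases h : a = b
  · subst h; simp
  · rw [Finset.sum_eq_zero]
    · simp [h]
    · intro c _
      have : ¬(c = a ∧ c = b) := fun hc => h (hc.1.symm.trans hc.2)
      simp [this]

lemma hashState_blk {β : Type*} [DecidableEq β] (f : α → β) (ω : α → Matrix n n ℂ) :
    hashState f (blk ω) = blk fun b => ∑ a with f a = b, ω a := by
  ext ⟨a, x⟩ ⟨b, y⟩
  simp [hashState, blk, Matrix.sum_apply]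

/-! ### Tensor powers and multiplicativity of the Rényi sum -/

/-- The tensor product of the matrices `X i`. -/
def piKron {n : Type*} {k : ℕ} (X : Fin k → Matrix n n ℂ) :
    Matrix (Fin k → n) (Fin k → n) ℂ :=
  Matrix.of fun x y => ∏ i, X i (x i) (y i)

lemma iidState_blk (ω : α → Matrix n n ℂ) (k : ℕ) :
    iidState (blk ω) k = blk fun a : Fin k → α => piKron fun i => ω (a i) := by
  ext ⟨a, x⟩ ⟨b, y⟩
  simp only [iidState, blk, piKron, of_apply]
  by_cases h : a = b
  · simp [h]
  · obtain ⟨i, hi⟩ := Function.ne_iff.1 h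
    rw [if_neg h, Finset.prod_eq_zero (Finset.mem_univ i)]
    simp [hi]

variable {k : ℕ}

lemma piKron_mul (X Y : Fin k → Matrix n n ℂ) :
    piKron X * piKron Y = piKron fun i => X i * Y i := by
  ext x y
  simp only [piKron, mul_apply, of_apply, ← Finset.prod_mul_distrib]
  exact (Finset.prod_univ_sum (fun _ : Fin k => Finset.univ)
    (fun i c => X i (x i) c * Y i c (y i))).symm ▸ by simp

lemma piKron_conjTranspose (X : Fin k → Matrix n n ℂ) :
    (piKron X)ᴴ = piKron fun i => (X i)ᴴ := by
  ext x y
  simp [piKron]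

lemma piKron_diagonal (r : Fin k → n → ℂ) :
    piKron (fun i => Matrix.diagonal (r i)) = Matrix.diagonal fun x => ∏ i, r i (x i) := by
  ext x y
  simp only [piKron, of_apply]
  by_cases h : x = y
  · simp [h]
  · obtain ⟨i, hi⟩ := Function.ne_iff.1 h
    rw [diagonal_apply_ne _ h, Finset.prod_eq_zero (Finset.mem_univ i)]
    simp [hi]

lemma piKron_one : piKron (fun _ : Fin k => (1 : Matrix n n ℂ)) = 1 := by
  simp_rw [← diagonal_one, piKron_diagonal]; simp

lemma piKron_trace (X : Fin k → Matrix n n ℂ) : (piKron X).trace = ∏ i, (X i).trace := by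
  simp only [trace, piKron, diag_apply, of_apply, Finset.prod_univ_sum, Fintype.piFinset_univ]

lemma sum_piKron (ω : α → Matrix n n ℂ) :
    ∑ a : Fin k → α, piKron (fun i => ω (a i)) = piKron fun _ => ∑ a, ω a := by
  ext x y
  simp only [piKron, Matrix.sum_apply, of_apply, Finset.prod_univ_sum, Fintype.piFinset_univ]

lemma piKron_unitary {U : Fin k → Matrix n n ℂ} (hU : ∀ a, U a ∈ unitaryGroup n ℂ) :
    piKron U ∈ unitaryGroup (Fin k → n) ℂ := by
  rw [mem_unitaryGroup_iff, star_eq_conjTranspose, piKron_conjTranspose, piKron_mul]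
  simp_rw [← star_eq_conjTranspose, fun a => mem_unitaryGroup_iff.1 (hU a), piKron_one]

lemma piKron_spec (U : Fin k → Matrix n n ℂ) (r : Fin k → n → ℝ) :
    piKron (fun i => spec (U i) (r i)) = spec (piKron U) fun x => ∏ i, r i (x i) := by
  have : (Matrix.diagonal fun x : Fin k → n => ((∏ i, r i (x i) : ℝ) : ℂ)) =
      piKron fun i => Matrix.diagonal fun j => (r i j : ℂ) := by
    rw [piKron_diagonal]; simp
  rw [spec, this, piKron_conjTranspose, piKron_mul, piKron_mul]
  rfl

lemma piKron_posSemidef {ω : Fin k → Matrix n n ℂ} (hω : ∀ a, (ω a).PosSemidef) :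
    (piKron ω).PosSemidef := by
  choose U hU r hr h using fun a => exists_spec_nonneg (hω a)
  simp_rw [funext h, piKron_spec]
  exact spec_posSemidef _ fun x => Finset.prod_nonneg fun i _ => hr i _

lemma matPow_piKron {ω : Fin k → Matrix n n ℂ} (hω : ∀ a, (ω a).PosSemidef) (s : ℝ) :
    matPow (piKron ω) s = piKron fun i => matPow (ω i) s := by
  choose U hU r hr h using fun a => exists_spec_nonneg (hω a)
  have h2 : (fun a => matPow (ω a) s) = fun a => spec (U a) fun i => r a i ^ s := by
    funext a; rw [h a, matPow_spec (hU a)]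
  rw [h2, piKron_spec, funext h, piKron_spec, matPow_spec (piKron_unitary hU)]
  congr 1
  funext x
  rw [Real.finsetProd_rpow _ _ fun i _ => hr i _]

/-- `∑ a, Tr ω_a^{1+s} σ^{-s}` with `σ = ∑ a, ω_a`. -/
def renyiSum (ω : α → Matrix n n ℂ) (s : ℝ) : ℝ :=
  ∑ a, (matPow (ω a) (1 + s) * matPow (∑ a, ω a) (-s)).trace.re

lemma posSemidef_sum {ω : α → Matrix n n ℂ} (hω : ∀ a, (ω a).PosSemidef) (S : Finset α) :
    (∑ a ∈ S, ω a).PosSemidef :=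
  Matrix.posSemidef_sum S fun a _ => hω a

/-- Taking real parts does not commute with products in general; since these traces are real, it
does in `renyiSum_iid`. -/
lemma matPow_mul_trace {X Y : Matrix n n ℂ} (hX : X.PosSemidef) (hY : Y.PosSemidef) (s t : ℝ) :
    ((matPow X s * matPow Y t).trace.re : ℂ) = (matPow X s * matPow Y t).trace := by
  obtain ⟨U, hU, r, hr, rfl⟩ := exists_spec_nonneg hX
  obtain ⟨V, hV, t, ht, rfl⟩ := exists_spec_nonneg hY
  rw [matPow_spec hU, matPow_spec hV, trace_spec_mul_spec, Complex.ofReal_re]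

lemma renyiSum_iid {ω : α → Matrix n n ℂ} (hω : ∀ a, (ω a).PosSemidef) (s : ℝ) :
    renyiSum (fun a : Fin k → α => piKron fun i => ω (a i)) s = renyiSum ω s ^ k := by
  have hσ := posSemidef_sum hω Finset.univ
  have h (a : Fin k → α) : (matPow (piKron fun i => ω (a i)) (1 + s) *
      matPow (piKron fun _ => ∑ a, ω a) (-s)).trace.re =
      ∏ i, (matPow (ω (a i)) (1 + s) * matPow (∑ a, ω a) (-s)).trace.re := by
    rw [matPow_piKron (fun i => hω (a i)), matPow_piKron (fun _ => hσ), piKron_mul, piKron_trace,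
      ← Complex.ofReal_inj, ← Complex.ofReal_re (∏ i, _), Complex.ofReal_prod]
    simp_rw [matPow_mul_trace (hω _) hσ]
  have hk (x : ℝ) : x ^ k = ∏ _i : Fin k, x := by simp
  simp only [renyiSum, sum_piKron, h, hk, Finset.prod_univ_sum, Fintype.piFinset_univ]

lemma condRenyi_blk {ω : α → Matrix n n ℂ} (hω : ∀ a, (ω a).PosSemidef) (s : ℝ) :
    condRenyi s (blk ω) = -1 / s * Real.log (renyiSum ω s) := by
  rw [condRenyi, traceA_blk, one_kronecker_eq_blk, matPow_blk (fun a => (hω a).1), blk_mul,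
    blk_trace, Complex.re_sum, renyiSum]

end Blocks

/-! ### A Pinsker-type inequality via square roots -/

section Pinsker

variable {n : Type*} [Fintype n] [DecidableEq n]

lemma relEntropy_spec {U V : Matrix n n ℂ} (hU : U ∈ unitaryGroup n ℂ) (hV : V ∈ unitaryGroup n ℂ)
    (r t : n → ℝ) : relEntropy (spec U r) (spec V t) =
      ∑ j, ∑ i, overlap U V i j * r i * (Real.log (r i) - Real.log (t j)) := by
  rw [relEntropy, matLog_spec hU, matLog_spec hV, mul_sub, trace_sub, Complex.sub_re,
    spec_mul_spec hU, trace_spec hU, trace_spec_mul_spec, Complex.ofReal_re, Complex.ofReal_re]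
  simp_rw [mul_sub, Finset.sum_sub_distrib]
  congr 1
  rw [Finset.sum_comm]
  refine Finset.sum_congr rfl fun i _ => ?_
  simp_rw [mul_assoc, ← Finset.sum_mul, sum_overlap_right hU hV, one_mul]

/-- This is `log x ≤ x - 1` at `x = √t / √r`, multiplied by `2r`. -/
lemma two_sub_two_sqrt_le {r t : ℝ} (hr : 0 ≤ r) (ht : 0 ≤ t) (h : t = 0 → r = 0) :
    2 * r - 2 * (√r * √t) ≤ r * (Real.log r - Real.log t) := by
  rcases hr.eq_or_lt with rfl | hr
  · simp
  have ht : 0 < t := lt_of_le_of_ne ht fun h0 => hr.ne' (h h0.symm)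
  have hs : 0 < √t / √r := div_pos (Real.sqrt_pos.2 ht) (Real.sqrt_pos.2 hr)
  have h1 := Real.log_le_sub_one_of_pos hs
  rw [Real.log_div (Real.sqrt_pos.2 ht).ne' (Real.sqrt_pos.2 hr).ne', Real.log_sqrt ht.le,
    Real.log_sqrt hr.le] at h1
  have h2 : r * (√t / √r) = √r * √t := by
    rw [mul_div_assoc', div_eq_iff (Real.sqrt_pos.2 hr).ne', mul_right_comm, Real.mul_self_sqrt hr.le]
  nlinarith [mul_le_mul_of_nonneg_left h1 hr.le]

/-- The relative entropy dominates the squared Hilbert–Schmidt distance of square roots. -/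
lemma hellinger_le_relEntropy {U V : Matrix n n ℂ} (hU : U ∈ unitaryGroup n ℂ)
    (hV : V ∈ unitaryGroup n ℂ) {r t : n → ℝ} (hr : ∀ i, 0 ≤ r i) (ht : ∀ i, 0 ≤ t i)
    (hrt : ∑ i, r i = ∑ i, t i) {C : ℝ} (hC : ((C : ℂ) • spec V t - spec U r).PosSemidef) :
    ((spec U (fun i => √(r i)) - spec V (fun i => √(t i))) *
      (spec U (fun i => √(r i)) - spec V (fun i => √(t i)))).trace.re ≤
    relEntropy (spec U r) (spec V t) := by
  have e1 : ∑ j, ∑ i, overlap U V i j * r i = ∑ i, r i := by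
    rw [Finset.sum_comm]
    simp_rw [← Finset.sum_mul, sum_overlap_right hU hV, one_mul]
  rw [sub_mul, mul_sub, mul_sub, spec_mul_spec hU, spec_mul_spec hV, trace_sub, trace_sub,
    trace_sub, trace_mul_comm (spec V _) (spec U _), trace_spec hU, trace_spec hV,
    trace_spec_mul_spec, relEntropy_spec hU hV]
  simp only [Real.mul_self_sqrt (hr _), Real.mul_self_sqrt (ht _), Complex.sub_re,
    Complex.ofReal_re]
  -- The square expands to `∑ r + ∑ t - 2 ∑ overlap √r √t`. Equal traces replace `∑ t` by `∑ r`, and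
  -- the scalar inequality then applies term by term wherever the overlap is nonzero.
  calc _ = ∑ j, ∑ i, overlap U V i j * (2 * r i - 2 * (√(r i) * √(t j))) := by
        simp_rw [mul_sub, Finset.sum_sub_distrib, mul_left_comm _ (2 : ℝ), ← Finset.mul_sum, e1,
          ← hrt, ← mul_assoc]
        ring
    _ ≤ _ := by
        refine Finset.sum_le_sum fun j _ => Finset.sum_le_sum fun i _ => ?_
        rw [mul_assoc]
        rcases eq_or_ne (overlap U V i j) 0 with h0 | h0
        · simp [h0]
        refine mul_le_mul_of_nonneg_left (two_sub_two_sqrt_le (hr i) (ht j) fun hj => ?_)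
          (overlap_nonneg ..)
        exact (mul_eq_zero.1 (overlap_mul_eq_zero hV hr hC i j hj)).resolve_left h0

lemma trace_conjTranspose_mul_self_re (X : Matrix n n ℂ) :
    (Xᴴ * X).trace.re = ∑ i, ∑ j, ‖X j i‖ ^ 2 := by
  simp only [trace, diag_apply, mul_apply, conjTranspose_apply, Complex.re_sum]
  refine Finset.sum_congr rfl fun i _ => Finset.sum_congr rfl fun j _ => ?_
  rw [Complex.star_def, ← Complex.normSq_eq_conj_mul_self, Complex.ofReal_re,
    Complex.normSq_eq_norm_sq]

/-- Cauchy–Schwarz for the Hilbert–Schmidt inner product. -/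
lemma trace_mul_re_sq_le (X Y : Matrix n n ℂ) :
    (Xᴴ * Y).trace.re ^ 2 ≤ (Xᴴ * X).trace.re * (Yᴴ * Y).trace.re := by
  have h1 : |(Xᴴ * Y).trace.re| ≤ ∑ p : n × n, ‖X p.2 p.1‖ * ‖Y p.2 p.1‖ := by
    refine (Complex.abs_re_le_norm _).trans ?_
    rw [trace, Fintype.sum_prod_type]
    refine (norm_sum_le _ _).trans (Finset.sum_le_sum fun i _ => ?_)
    rw [diag_apply, mul_apply]
    refine (norm_sum_le _ _).trans (Finset.sum_le_sum fun j _ => ?_)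
    simp
  rw [trace_conjTranspose_mul_self_re, trace_conjTranspose_mul_self_re, ← Fintype.sum_prod_type',
    ← Fintype.sum_prod_type']
  calc _ = |(Xᴴ * Y).trace.re| ^ 2 := (sq_abs _).symm
    _ ≤ (∑ p : n × n, ‖X p.2 p.1‖ * ‖Y p.2 p.1‖) ^ 2 := by gcongr
    _ ≤ _ := Finset.sum_mul_sq_le_sq_mul_sq _ _ _

/-- The trace norm of a Hermitian matrix `X` is `Tr X S` for a self-adjoint unitary `S`. -/
lemma exists_traceNorm_eq {X : Matrix n n ℂ} (hX : X.IsHermitian) :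
    ∃ S : Matrix n n ℂ, S.IsHermitian ∧ S * S = 1 ∧ traceNorm X = (X * S).trace.re := by
  obtain ⟨U, hU, r, rfl⟩ := exists_spec hX
  -- The sign of `X`, with sign `+1` on the kernel so that it squares to the identity.
  refine ⟨spec U fun i => if 0 ≤ r i then 1 else -1, spec_isHermitian _ _, ?_, ?_⟩
  · rw [spec_mul_spec hU]
    have : (fun i => (if 0 ≤ r i then (1 : ℝ) else -1) * if 0 ≤ r i then 1 else -1) =
        fun _ => (1 : ℝ) := by
      funext i; split_ifs <;> norm_num
    rw [this, spec_const hU]; simp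
  · rw [traceNorm, (spec_isHermitian U r).eq, spec_mul_spec hU, spec_mul_spec hU, cfc_spec hU,
      trace_spec hU, trace_spec hU, Complex.ofReal_re, Complex.ofReal_re]
    refine Finset.sum_congr rfl fun i _ => ?_
    rw [Real.sqrt_mul_self_eq_abs]
    split_ifs with h
    · simp [abs_of_nonneg h]
    · simp [abs_of_neg (not_le.1 h)]

/-- A Pinsker-type inequality. -/
theorem traceNorm_sub_sq_le {ρ σ : Matrix n n ℂ} (hρ : IsDensity ρ) (hσ : IsDensity σ)
    {C : ℝ} (hC : ((C : ℂ) • σ - ρ).PosSemidef) :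
    traceNorm (ρ - σ) ^ 2 ≤ 4 * relEntropy ρ σ := by
  obtain ⟨hρ, hρ1⟩ := hρ
  obtain ⟨hσ, hσ1⟩ := hσ
  obtain ⟨S, hS, hSS, hT⟩ := exists_traceNorm_eq (hρ.1.sub hσ.1)
  rw [hT]
  obtain ⟨U, hU, r, hr, rfl⟩ := exists_spec_nonneg hρ
  obtain ⟨V, hV, t, ht, rfl⟩ := exists_spec_nonneg hσ
  have hr1 : ∑ i, r i = 1 := by
    rw [trace_spec hU] at hρ1; exact_mod_cast hρ1
  have ht1 : ∑ i, t i = 1 := by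
    rw [trace_spec hV] at hσ1; exact_mod_cast hσ1
  have hH := hellinger_le_relEntropy hU hV hr ht (hr1.trans ht1.symm) hC
  set A := spec U (fun i => √(r i)) with hA
  set B := spec V (fun i => √(t i)) with hB
  have hAA : A * A = spec U r := by
    rw [hA, spec_mul_spec hU]; simp [Real.mul_self_sqrt (hr _)]
  have hBB : B * B = spec V t := by
    rw [hB, spec_mul_spec hV]; simp [Real.mul_self_sqrt (ht _)]
  have hAh : Aᴴ = A := spec_isHermitian _ _
  have hBh : Bᴴ = B := spec_isHermitian _ _
  have hSh : Sᴴ = S := hS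
  set D := A - B with hD
  set E := A + B with hE
  have hDh : Dᴴ = D := by rw [hD, conjTranspose_sub, hAh, hBh]
  have hEh : Eᴴ = E := by rw [hE, conjTranspose_add, hAh, hBh]
  -- Noncommutative form of `a² - b² = (a - b)(a + b)` for the square roots of the two states.
  have hsplit : spec U r - spec V t = (1 / 2 : ℂ) • (D * E + E * D) := by
    rw [← hAA, ← hBB, hD, hE]
    have : (A - B) * (A + B) + (A + B) * (A - B) = (2 : ℂ) • (A * A - B * B) := by
      rw [two_smul]; noncomm_ring
    rw [this, smul_smul]; norm_num
  -- The two traces are complex conjugates of each other, so both halves of the symmetrized product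
  -- contribute equally.
  have hconj : (E * D * S).trace.re = (D * (E * S)).trace.re := by
    have h1 : (D * (E * S))ᴴ = S * (E * D) := by
      rw [conjTranspose_mul, conjTranspose_mul, hSh, hDh, hEh, mul_assoc]
    rw [trace_mul_comm (E * D) S, ← h1, trace_conjTranspose]
    simp
  have htr : ((spec U r - spec V t) * S).trace.re = (D * (E * S)).trace.re := by
    rw [hsplit, Matrix.smul_mul, add_mul, trace_smul, trace_add, smul_eq_mul, mul_add,
      Complex.add_re, show (1 / 2 : ℂ) = ((1 / 2 : ℝ) : ℂ) by simp, Complex.re_ofReal_mul,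
      Complex.re_ofReal_mul, hconj, mul_assoc D]
    ring
  have hCS := trace_mul_re_sq_le D (E * S)
  have hES : ((E * S)ᴴ * (E * S)).trace = (E * E).trace := by
    rw [trace_mul_comm, conjTranspose_mul, hSh, hEh,
      show E * S * (S * E) = E * (S * S) * E by simp only [mul_assoc], hSS, mul_one]
  -- Parallelogram identity: `E² + D² = 2 (ρ + σ)` has trace `4`. This is the constant of the
  -- theorem.
  have hEE : (E * E).trace.re ≤ 4 := by
    have h1 : (E * E).trace.re + (D * D).trace.re = 4 := by
      rw [← Complex.add_re, ← trace_add,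
        show E * E + D * D = (2 : ℂ) • (A * A + B * B) by
          rw [hD, hE, two_smul]; noncomm_ring,
        hAA, hBB, trace_smul, trace_add, hρ1, hσ1]
      norm_num
    have h2 : 0 ≤ (D * D).trace.re := by
      have := trace_conjTranspose_mul_self_re D
      rw [hDh] at this
      rw [this]; positivity
    linarith
  have hDD : 0 ≤ (D * D).trace.re := by
    have := trace_conjTranspose_mul_self_re D
    rw [hDh] at this
    rw [this]; positivity
  rw [hDh, hES] at hCS
  rw [htr]
  nlinarith

end Pinsker

/-! ### Pinching -/

section Pinching

variable {D o : Type*} [Fintype D] [DecidableEq D] [Fintype o] [DecidableEq o]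

/-- The pinching of `W` with respect to the fibres of `k`. -/
def pinch (k : D → o) (W : Matrix D D ℂ) : Matrix D D ℂ :=
  Matrix.of fun i j => if k i = k j then W i j else 0

/-- The pinching inequality. -/
lemma pinch_le (k : D → o) {W : Matrix D D ℂ} (hW : W.PosSemidef) :
    ((Fintype.card o : ℂ) • pinch k W - W).PosSemidef := by
  set p : o → Matrix D D ℂ := fun l => Matrix.diagonal fun i => if k i = l then 1 else 0 with hp
  -- With `p l` the projection onto the fibre over `l`, each of the two diagonal terms sums to `|o|
  -- · pinch k W` and each of the two cross terms to `-W`.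
  have hsum : ((2 : ℝ) : ℂ) • ((Fintype.card o : ℂ) • pinch k W - W) =
      ∑ l, ∑ m, (p l - p m) * W * (p l - p m)ᴴ := by
    ext i j
    simp only [hp, diagonal_sub, diagonal_conjTranspose, Matrix.sum_apply, mul_diagonal,
      diagonal_mul, Matrix.smul_apply, Matrix.sub_apply, pinch, of_apply, smul_eq_mul, Pi.star_apply]
    simp only [star_sub, apply_ite star, star_one, star_zero]
    have e (l m : o) : ((if k i = l then (1 : ℂ) else 0) - if k i = m then 1 else 0) * W i j *
        ((if k j = l then 1 else 0) - if k j = m then 1 else 0) =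
        ((if k i = l then (if k j = l then 1 else 0) else 0)
         + (if k i = m then (if k j = m then 1 else 0) else 0)
         - (if k i = l then (1 : ℂ) else 0) * (if k j = m then 1 else 0)
         - (if k i = m then (1 : ℂ) else 0) * (if k j = l then 1 else 0)) * W i j := by
      split_ifs <;> ring
    simp only [e, ← Finset.sum_mul, Finset.sum_sub_distrib, Finset.sum_add_distrib,
      ← Finset.mul_sum]
    simp only [Finset.sum_ite_eq, Finset.mem_univ, if_true, Finset.sum_const, Finset.card_univ,
      nsmul_eq_mul]
    by_cases h : k i = k j
    · simp [h]; ring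
    · simp [h, Ne.symm h]; ring
  have h2 : (((1 / 2 : ℝ) : ℂ) • ((2 : ℝ) : ℂ) •
      ((Fintype.card o : ℂ) • pinch k W - W)).PosSemidef := by
    rw [hsum]
    refine PosSemidef.smul ?_ (by rw [Complex.zero_le_real]; norm_num)
    exact Matrix.posSemidef_sum _ fun l _ => Matrix.posSemidef_sum _ fun m _ =>
      hW.mul_mul_conjTranspose_same _
  rwa [smul_smul, ← Complex.ofReal_mul, show (1 / 2 * 2 : ℝ) = 1 by norm_num, Complex.ofReal_one,
    one_smul] at h2

/-- A pinched Hermitian matrix is diagonal in a basis that respects the fibres. -/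
lemma exists_pinch_eq_spec (k : D → o) {W : Matrix D D ℂ} (hW : W.IsHermitian) :
    ∃ Q ∈ unitaryGroup D ℂ, (∀ i j, k i ≠ k j → Q i j = 0) ∧
      ∃ r : D → ℝ, pinch k W = spec Q r := by
  have hB (l : o) : (W.submatrix (fun i : {i // k i = l} => i.1) fun i => i.1).IsHermitian :=
    hW.submatrix _
  choose U hU r hr using fun l => exists_spec (hB l)
  set e : D ≃ Σ l, {i // k i = l} := (Equiv.sigmaFiberEquiv k).symm with he
  -- Each fibre is diagonalized separately, and the unitaries are glued along the partition of `D`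
  -- into fibres.
  have hbU : blockDiagonal' U * (blockDiagonal' U)ᴴ = 1 := by
    rw [blockDiagonal'_conjTranspose, ← blockDiagonal'_mul]
    simp_rw [← star_eq_conjTranspose, fun l => mem_unitaryGroup_iff.1 (hU l)]
    exact blockDiagonal'_one
  refine ⟨(blockDiagonal' U).submatrix e e, ?_, ?_, fun i => r (e i).1 (e i).2, ?_⟩
  · rw [mem_unitaryGroup_iff, star_eq_conjTranspose, conjTranspose_submatrix,
      submatrix_mul_equiv, hbU, submatrix_one_equiv]
  · intro i j hij
    exact blockDiagonal'_apply_ne U (e i).2 (e j).2 hij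
  · have h1 : pinch k W = (blockDiagonal' fun l => W.submatrix (fun i : {i // k i = l} => i.1)
        fun i => i.1).submatrix e e := by
      have key (x y : Σ l, {i // k i = l}) : pinch k W x.2.1 y.2.1 =
          blockDiagonal' (fun l => W.submatrix (fun i : {i // k i = l} => i.1) fun i => i.1) x y := by
        obtain ⟨l, i, hi⟩ := x
        obtain ⟨m, j, hj⟩ := y
        by_cases h : l = m
        · subst h
          simp [pinch, hi, hj, blockDiagonal'_apply_eq]
        · rw [blockDiagonal'_apply_ne _ _ _ h]
          simp [pinch, hi, hj, h]
      ext i j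
      exact key (e i) (e j)
    have h2 : (Matrix.diagonal fun i => (r (e i).1 (e i).2 : ℂ)) =
        (blockDiagonal' fun l => Matrix.diagonal fun i => (r l i : ℂ)).submatrix e e := by
      rw [blockDiagonal'_diagonal, submatrix_diagonal_equiv]; rfl
    rw [h1, spec, h2, conjTranspose_submatrix, submatrix_mul_equiv, submatrix_mul_equiv,
      blockDiagonal'_conjTranspose, ← blockDiagonal'_mul, ← blockDiagonal'_mul]
    congr 2
    exact funext hr

/-- Column `j` of `Q` lives on the fibre of `k j`, where the pinching changes nothing. -/
lemma diagIn_pinch (k : D → o) (W : Matrix D D ℂ) {Q : Matrix D D ℂ}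
    (hQ : ∀ i j, k i ≠ k j → Q i j = 0) (j : D) :
    diagIn Q (pinch k W) j = diagIn Q W j := by
  simp only [diagIn, mul_apply, conjTranspose_apply, pinch, of_apply]
  congr 1
  refine Finset.sum_congr rfl fun l _ => ?_
  by_cases hl : k l = k j
  · congr 1
    refine Finset.sum_congr rfl fun i _ => ?_
    by_cases hi : k i = k j
    · simp [hi, hl]
    · simp [hQ i j hi]
  · simp [hQ l j hl]

/-- A basis which diagonalizes `σ` and the pinching of `ω` at once. -/
lemma exists_pinching_basis {V : Matrix D D ℂ} (hV : V ∈ unitaryGroup D ℂ) (k : D → o)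
    {ω : Matrix D D ℂ} (hω : ω.PosSemidef) :
    ∃ V' ∈ unitaryGroup D ℂ, (∀ u : o → ℝ, spec V (fun i => u (k i)) = spec V' fun i => u (k i)) ∧
      ((Fintype.card o : ℂ) • spec V' (diagIn V' ω) - ω).PosSemidef := by
  have hVV : V * Vᴴ = 1 := mem_unitaryGroup_iff.1 hV
  have hW := hω.conjTranspose_mul_mul_same V
  obtain ⟨Q, hQ, hQk, r, hr⟩ := exists_pinch_eq_spec k hW.1
  have hQQ : Q * Qᴴ = 1 := mem_unitaryGroup_iff.1 hQ
  have hdiag : diagIn (V * Q) ω = r := by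
    funext j
    have h1 : diagIn (V * Q) ω j = diagIn Q (Vᴴ * ω * V) j := by
      simp only [diagIn, conjTranspose_mul, mul_assoc]
    rw [h1, ← diagIn_pinch k _ hQk, hr, diagIn_spec_self hQ]
  refine ⟨V * Q, mul_mem hV hQ, fun u => ?_, ?_⟩
  -- On each fibre the diagonal matrix is scalar, and `Q` preserves fibres.
  · have hcomm : Q * Matrix.diagonal (fun i => (u (k i) : ℂ)) =
        Matrix.diagonal (fun i => (u (k i) : ℂ)) * Q := by
      ext i j
      rw [mul_diagonal, diagonal_mul]
      by_cases h : k i = k j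
      · rw [h, mul_comm]
      · simp [hQk i j h]
    calc spec V (fun i => u (k i)) =
          V * (Matrix.diagonal (fun i => (u (k i) : ℂ)) * (Q * Qᴴ)) * Vᴴ := by
          rw [hQQ, mul_one, spec]
      _ = V * (Q * Matrix.diagonal (fun i => (u (k i) : ℂ)) * Qᴴ) * Vᴴ := by
          simp only [hcomm, mul_assoc]
      _ = _ := by simp only [spec, conjTranspose_mul, mul_assoc]
  · have h := (pinch_le k hW).mul_mul_conjTranspose_same V
    have e : V * ((Fintype.card o : ℂ) • pinch k (Vᴴ * ω * V) - Vᴴ * ω * V) * Vᴴ =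
        (Fintype.card o : ℂ) • spec (V * Q) (diagIn (V * Q) ω) - ω := by
      rw [hdiag, hr, mul_sub, sub_mul, Matrix.mul_smul, Matrix.smul_mul]
      congr 1
      · simp only [spec, conjTranspose_mul, mul_assoc]
      · calc _ = (V * Vᴴ) * ω * (V * Vᴴ) := by simp only [mul_assoc]
          _ = ω := by rw [hVV, one_mul, mul_one]
    rwa [e] at h

end Pinching

/-! ### One-shot privacy amplification -/

section OneShot

variable {D : Type*} [Fintype D] [DecidableEq D]

lemma trace_mul_mono {ω X Y : Matrix D D ℂ} (hω : ω.PosSemidef) (hXY : (Y - X).PosSemidef) :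
    (ω * X).trace.re ≤ (ω * Y).trace.re := by
  obtain ⟨U, hU, r, hr, rfl⟩ := exists_spec_nonneg hω
  have h : 0 ≤ (spec U r * (Y - X)).trace.re := by
    rw [trace_mul_comm, trace_mul_spec hXY.1, Complex.ofReal_re]
    exact Finset.sum_nonneg fun j _ => mul_nonneg (diagIn_nonneg hXY U j) (hr j)
  rw [mul_sub, trace_sub, Complex.sub_re] at h
  linarith

open scoped MatrixOrder Matrix.Norms.L2Operator in
lemma matLog_mono {X Y : Matrix D D ℂ} (hX : X.PosDef) (hXY : (Y - X).PosSemidef) :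
    (matLog Y - matLog X).PosSemidef :=
  CFC.log_le_log (A := Matrix D D ℂ) (a := X) (b := Y) hXY hX.isStrictlyPositive

open scoped MatrixOrder Matrix.Norms.L2Operator in
lemma matLog_concave {ι : Type*} (S : Finset ι) {w : ι → ℝ} (hw : ∀ i ∈ S, 0 ≤ w i)
    (hw1 : ∑ i ∈ S, w i = 1) {X : ι → Matrix D D ℂ} (hX : ∀ i ∈ S, (X i).PosDef) :
    (matLog (∑ i ∈ S, w i • X i) - ∑ i ∈ S, w i • matLog (X i)).PosSemidef :=
  (CFC.concaveOn_log (A := Matrix D D ℂ)).le_map_sum hw hw1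
    fun i hi => (hX i hi).isStrictlyPositive

/-- From `s log (1 + x) = log (1 + x)^s ≤ log (1 + x^s) ≤ x^s`; subadditivity of `y ↦ y^s` is where
`s ≤ 1` enters. -/
lemma log_one_add_le {s x : ℝ} (hs : 0 < s) (hs1 : s ≤ 1) (hx : 0 ≤ x) :
    Real.log (1 + x) ≤ x ^ s / s := by
  rw [le_div_iff₀ hs, mul_comm, ← Real.log_rpow (by linarith)]
  have h1 : (1 + x) ^ s ≤ 1 + x ^ s := by
    simpa using Real.rpow_add_le_add_rpow zero_le_one hx hs.le hs1
  have h2 : 0 < (1 + x) ^ s := Real.rpow_pos_of_pos (by linarith) _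
  have := Real.log_le_sub_one_of_pos (h2.trans_le h1)
  linarith [Real.log_le_log h2 h1]

lemma mul_log_sub_log_le {s r t c ε v : ℝ} (hs : 0 < s) (hs1 : s ≤ 1) (hr : 0 ≤ r) (ht : 0 ≤ t)
    (h : t = 0 → r = 0) (hc : 0 < c) (hε : 0 < ε) (hv : 0 ≤ v) :
    r * (Real.log (v * r + (c * t + ε)) - Real.log (c * t + ε)) ≤
      (v / c) ^ s / s * (r ^ (1 + s) * t ^ (-s)) := by
  rcases hr.eq_or_lt with rfl | hr
  · simp [Real.zero_rpow (by linarith : 1 + s ≠ 0)]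
  have ht : 0 < t := lt_of_le_of_ne ht fun h0 => hr.ne' (h h0.symm)
  have hq : 0 < c * t + ε := by positivity
  have h1 : Real.log (v * r + (c * t + ε)) - Real.log (c * t + ε) ≤ (v * r / (c * t)) ^ s / s := by
    rw [← Real.log_div (by positivity) hq.ne', add_div, div_self hq.ne', add_comm]
    refine (log_one_add_le hs hs1 (by positivity)).trans ?_
    gcongr
    linarith
  have h2 : r ^ (1 + s) = r * r ^ s := by rw [Real.rpow_add hr, Real.rpow_one]
  calc _ ≤ r * ((v * r / (c * t)) ^ s / s) := by gcongr
    _ = _ := by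
      rw [h2, Real.rpow_neg ht.le, Real.div_rpow (by positivity) (by positivity),
        Real.mul_rpow hv hr.le, Real.mul_rpow hc.le ht.le, Real.div_rpow hv hc.le]
      field_simp

/-- Jensen's inequality: each diagonal entry is an average of eigenvalues, weighted by the squared
overlaps. -/
lemma diagIn_rpow_le {ω V : Matrix D D ℂ} (hω : ω.PosSemidef) (hV : V ∈ unitaryGroup D ℂ)
    {p : ℝ} (hp : 1 ≤ p) (j : D) : diagIn V ω j ^ p ≤ diagIn V (matPow ω p) j := by
  obtain ⟨U, hU, r, hr, rfl⟩ := exists_spec_nonneg hω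
  rw [matPow_spec hU, diagIn_spec, diagIn_spec]
  exact Real.rpow_arith_mean_le_arith_mean_rpow _ _ _ (fun i _ => overlap_nonneg ..)
    (sum_overlap_left hU hV j) (fun i _ => hr i) hp

lemma matPow_isHermitian {X : Matrix D D ℂ} (hX : X.IsHermitian) (s : ℝ) :
    (matPow X s).IsHermitian := by
  obtain ⟨U, hU, r, rfl⟩ := exists_spec hX
  rw [matPow_spec hU]; exact spec_isHermitian _ _

/-- In a basis that diagonalizes both `σ` and the pinched `ω`, the pinching inequality and
monotonicity of the logarithm reduce the claim to `mul_log_sub_log_le` for each diagonal entry. -/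
lemma trace_mul_log_le {o : Type*} [Fintype o] [DecidableEq o] {V : Matrix D D ℂ}
    (hV : V ∈ unitaryGroup D ℂ) (k : D → o) {u : o → ℝ} (hu : ∀ l, 0 ≤ u l)
    {ω : Matrix D D ℂ} (hω : ω.PosSemidef) (hωσ : (spec V (fun i => u (k i)) - ω).PosSemidef)
    {c ε s : ℝ} (hc : 0 < c) (hε : 0 < ε) (hs : 0 < s) (hs1 : s ≤ 1) :
    (ω * matLog (ω + spec V fun i => c * u (k i) + ε)).trace.re ≤
      (ω * matLog (spec V fun i => c * u (k i) + ε)).trace.re + (Fintype.card o / c) ^ s / s *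
        (matPow ω (1 + s) * matPow (spec V fun i => u (k i)) (-s)).trace.re := by
  obtain ⟨V', hV', hVV', hle⟩ := exists_pinching_basis hV k hω
  rw [hVV' u] at hωσ ⊢
  rw [hVV' fun x => c * u x + ε]
  set r := diagIn V' ω with hr
  have hr0 : ∀ j, 0 ≤ r j := diagIn_nonneg hω V'
  have hq : ∀ j, 0 < c * u (k j) + ε := fun j => by have := hu (k j); positivity
  -- The support condition from `ω ≤ σ`; without it the convention `0 ^ (-s) = 0` would spoil the
  -- scalar bound.
  have hrt (j : D) (h0 : u (k j) = 0) : r j = 0 := by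
    have h := diagIn_nonneg hωσ V' j
    rw [diagIn_sub, diagIn_spec_self hV', h0] at h
    exact le_antisymm (by linarith) (hr0 j)
  have h1 : (ω * matLog (ω + spec V' fun i => c * u (k i) + ε)).trace.re ≤
      ∑ j, r j * Real.log (Fintype.card o * r j + (c * u (k j) + ε)) := by
    refine (trace_mul_mono hω (matLog_mono ((spec_posDef hV' hq).posSemidef_add hω)
      (Y := spec V' fun j => (Fintype.card o : ℝ) * r j + (c * u (k j) + ε)) ?_)).trans_eq ?_
    · rw [← spec_add, ← spec_smul, add_sub_add_right_eq_sub, Complex.ofReal_natCast]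
      exact hle
    · rw [matLog_spec hV', trace_mul_spec hω.1, Complex.ofReal_re]
  rw [matLog_spec hV', trace_mul_spec hω.1, Complex.ofReal_re, matPow_spec hV',
    trace_mul_spec (matPow_isHermitian hω.1 _), Complex.ofReal_re]
  refine h1.trans ?_
  rw [← sub_le_iff_le_add', ← Finset.sum_sub_distrib, Finset.mul_sum]
  refine Finset.sum_le_sum fun j _ => ?_
  rw [← mul_sub]
  refine (mul_log_sub_log_le hs hs1 (hr0 j) (hu _) (hrt j) hc hε (Nat.cast_nonneg _)).trans ?_
  gcongr
  · exact Real.rpow_nonneg (hu _) _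
  · exact diagIn_rpow_le hω hV' (by linarith) j

variable {α : Type*} [Fintype α] [DecidableEq α]

/-- The uniformly random function `α → Fin M` is pairwise independent. -/
lemma card_collision {M : ℕ} [NeZero M] {a a' : α} (h : a' ≠ a) :
    M * (Finset.univ.filter fun f : α → Fin M => f a' = f a).card =
      Fintype.card (α → Fin M) := by
  -- Shifting the value at `a'` by `c` is a bijection of functions, so all `M` values of `f a' - f
  -- a` are equally frequent.
  have hc (c : Fin M) : (Finset.univ.filter fun f : α → Fin M => f a' = f a + c).card =
      (Finset.univ.filter fun f : α → Fin M => f a' = f a).card := by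
    refine (Finset.card_equiv (Equiv.addRight (Pi.single a' c : α → Fin M)) fun f => ?_).symm
    simp [h.symm]
  have hf := Finset.card_eq_sum_card_fiberwise
    (f := fun f : α → Fin M => f a' - f a) (s := Finset.univ) (t := Finset.univ) (by simp)
  rw [← Finset.card_univ, hf]
  have (c : Fin M) : (Finset.univ.filter fun f : α → Fin M => f a' - f a = c) =
      Finset.univ.filter fun f : α → Fin M => f a' = f a + c := by
    ext f; simp [sub_eq_iff_eq_add, add_comm]
  simp [this, hc]

lemma sum_bins {M : ℕ} [NeZero M] (ω : α → Matrix D D ℂ) (a : α) :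
    ∑ f : α → Fin M, (Fintype.card (α → Fin M) : ℝ)⁻¹ • ∑ a' with f a' = f a, ω a' =
      ω a + ((M : ℝ)⁻¹) • (∑ a', ω a' - ω a) := by
  have hN : (Fintype.card (α → Fin M) : ℝ) ≠ 0 := by
    exact_mod_cast Fintype.card_ne_zero
  have hM : (M : ℝ) ≠ 0 := by exact_mod_cast NeZero.ne M
  have e1 : ∑ f : α → Fin M, ∑ a' with f a' = f a, ω a' =
      ∑ a', ((Finset.univ.filter fun f : α → Fin M => f a' = f a).card : ℝ) • ω a' := by
    simp_rw [Finset.sum_filter]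
    rw [Finset.sum_comm]
    refine Finset.sum_congr rfl fun a' _ => ?_
    rw [← Finset.sum_filter, Finset.sum_const, Nat.cast_smul_eq_nsmul]
  rw [← Finset.smul_sum, e1, Finset.smul_sum,
    ← Finset.add_sum_erase _ _ (Finset.mem_univ a)]
  congr 1
  · simp only [Finset.filter_true, Finset.card_univ, smul_smul, inv_mul_cancel₀ hN, one_smul]
  · rw [← Finset.add_sum_erase _ ω (Finset.mem_univ a), add_sub_cancel_left, Finset.smul_sum]
    refine Finset.sum_congr rfl fun a' ha' => ?_
    have := card_collision (M := M) (Finset.ne_of_mem_erase ha')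
    rw [smul_smul, ← this]
    congr 1
    push_cast
    have h0 : ((Finset.univ.filter fun f : α → Fin M => f a' = f a).card : ℝ) ≠ 0 := by
      intro h0
      apply hN
      rw [← this]; push_cast; rw [h0, mul_zero]
    field_simp

lemma real_smul_eq (c : ℝ) (X : Matrix D D ℂ) : c • X = (c : ℂ) • X := by
  ext i j; simp

/-- Operator concavity moves the mean inside the logarithm, where `sum_bins` evaluates it;
monotonicity then discards the term `-ω a / M`. -/
lemma trace_mul_log_avg_le {M : ℕ} [NeZero M] {ω : α → Matrix D D ℂ}
    (hω : ∀ a, (ω a).PosSemidef) {κ : Matrix D D ℂ} {ε : ℝ} (hε : 0 < ε)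
    (hκ : κ = ((M : ℝ)⁻¹ : ℂ) • ∑ a, ω a + (ε : ℂ) • 1) (a : α) :
    ∑ f : α → Fin M, (Fintype.card (α → Fin M) : ℝ)⁻¹ *
      (ω a * matLog (∑ a' with f a' = f a, ω a' + (ε : ℂ) • 1)).trace.re ≤
      (ω a * matLog (ω a + κ)).trace.re := by
  have hN : (Fintype.card (α → Fin M) : ℝ) ≠ 0 := by
    exact_mod_cast Fintype.card_ne_zero
  have hεp : ((ε : ℂ) • (1 : Matrix D D ℂ)).PosDef :=
    PosDef.one.smul (by exact_mod_cast hε)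
  have hX (f : α → Fin M) : (∑ a' with f a' = f a, ω a' + (ε : ℂ) • 1).PosDef :=
    hεp.posSemidef_add (posSemidef_sum hω _)
  have hw1 : ∑ f : α → Fin M, (Fintype.card (α → Fin M) : ℝ)⁻¹ = 1 := by
    simp [Finset.card_univ]
  have h1 := trace_mul_mono (hω a) (matLog_concave Finset.univ
    (w := fun _ => (Fintype.card (α → Fin M) : ℝ)⁻¹) (fun _ _ => by positivity) hw1
    fun f _ => hX f)
  have h2 : ∑ f : α → Fin M, (Fintype.card (α → Fin M) : ℝ)⁻¹ •
      (∑ a' with f a' = f a, ω a' + (ε : ℂ) • (1 : Matrix D D ℂ)) =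
      ω a + ((M : ℝ)⁻¹) • (∑ a', ω a' - ω a) + (ε : ℂ) • 1 := by
    simp_rw [smul_add, Finset.sum_add_distrib, sum_bins, ← Finset.sum_smul, hw1, one_smul]
  have hM0 : (0 : ℝ) ≤ (M : ℝ)⁻¹ := by positivity
  have hposd : (ω a + ((M : ℝ)⁻¹) • (∑ a', ω a' - ω a) + (ε : ℂ) • 1).PosDef := by
    refine hεp.posSemidef_add ((hω a).add ?_)
    rw [real_smul_eq]
    refine PosSemidef.smul ?_ (by exact_mod_cast hM0)
    rw [← Finset.add_sum_erase _ ω (Finset.mem_univ a), add_sub_cancel_left]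
    exact posSemidef_sum hω _
  have h3 := trace_mul_mono (hω a) (matLog_mono hposd (Y := ω a + κ) (by
    rw [hκ, real_smul_eq, smul_sub]
    have : ω a + ((((M : ℝ)⁻¹ : ℝ) : ℂ) • ∑ a, ω a + (ε : ℂ) • 1) -
        (ω a + ((((M : ℝ)⁻¹ : ℝ) : ℂ) • ∑ a, ω a - (((M : ℝ)⁻¹ : ℝ) : ℂ) • ω a) + (ε : ℂ) • 1) =
        (((M : ℝ)⁻¹ : ℝ) : ℂ) • ω a := by abel
    push_cast at this ⊢
    rw [this]
    have h0 := Complex.zero_le_real.2 hM0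
    push_cast at h0
    exact (hω a).smul h0))
  rw [h2] at h1
  refine le_trans (le_of_eq ?_) (h1.trans h3)
  rw [Matrix.mul_sum, trace_sum, Complex.re_sum]
  refine Finset.sum_congr rfl fun f _ => ?_
  rw [real_smul_eq, Matrix.mul_smul, trace_smul, smul_eq_mul, Complex.re_ofReal_mul]

/-- The regularization commutes with `X`, so the comparison is eigenvalue by eigenvalue; zero
eigenvalues carry zero weight. -/
lemma trace_mul_log_self_le {X : Matrix D D ℂ} (hX : X.PosSemidef) {ε : ℝ} (hε : 0 < ε) :
    (X * matLog X).trace.re ≤ (X * matLog (X + (ε : ℂ) • 1)).trace.re := by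
  obtain ⟨U, hU, r, hr, rfl⟩ := exists_spec_nonneg hX
  rw [← spec_const hU, spec_add, matLog_spec hU, matLog_spec hU, spec_mul_spec hU,
    spec_mul_spec hU, trace_spec hU, trace_spec hU, Complex.ofReal_re, Complex.ofReal_re]
  refine Finset.sum_le_sum fun i _ => ?_
  rcases (hr i).eq_or_lt with h | h
  · simp [← h]
  · gcongr
    linarith

lemma sum_bins_trace {β : Type*} [Fintype β] [DecidableEq β] (f : α → β) (ω : α → Matrix D D ℂ)
    (Y : β → Matrix D D ℂ) :
    ∑ b, ((∑ a with f a = b, ω a) * Y b).trace.re = ∑ a, (ω a * Y (f a)).trace.re := by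
  rw [← Finset.sum_fiberwise Finset.univ f]
  refine Finset.sum_congr rfl fun b _ => ?_
  rw [Matrix.sum_mul, trace_sum, Complex.re_sum]
  refine Finset.sum_congr rfl fun a ha => ?_
  rw [(Finset.mem_filter.1 ha).2]

lemma modMutualInfo_hash {β : Type*} [Fintype β] [DecidableEq β] (f : α → β)
    {ω : α → Matrix D D ℂ} (hω : ∀ a, (ω a).PosSemidef) :
    modMutualInfo (hashState f (blk ω)) =
      ∑ b, ((∑ a with f a = b, ω a) * matLog (∑ a with f a = b, ω a)).trace.re -
      ((∑ a, ω a) * matLog (((Fintype.card β : ℂ)⁻¹) • ∑ a, ω a)).trace.re := by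
  have hS : ∑ b, ∑ a with f a = b, ω a = ∑ a, ω a := Finset.sum_fiberwise _ _ _
  have hc : (0 : ℂ) ≤ (Fintype.card β : ℂ)⁻¹ := by
    rw [← Complex.ofReal_natCast, ← Complex.ofReal_inv, Complex.zero_le_real]; positivity
  rw [modMutualInfo, hashState_blk, traceA_blk, hS, mixedState_kronecker, relEntropy,
    matLog_blk fun b => (posSemidef_sum hω _).1,
    matLog_blk fun b => ((posSemidef_sum hω _).smul hc).1, blk_sub, blk_mul, blk_trace,
    Complex.re_sum]
  simp_rw [mul_sub, trace_sub, Complex.sub_re]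
  rw [Finset.sum_sub_distrib]
  congr 1
  rw [sum_bins_trace f ω fun _ => matLog (((Fintype.card β : ℂ)⁻¹) • ∑ a, ω a), Matrix.sum_mul,
    trace_sum, Complex.re_sum]

/-- Privacy amplification with a random function, one-shot form. -/
theorem exists_hash_modMutualInfo_le {o : Type*} [Fintype o] [DecidableEq o] {V : Matrix D D ℂ}
    (hV : V ∈ unitaryGroup D ℂ) (k : D → o) {u : o → ℝ} (hu : ∀ l, 0 ≤ u l)
    {ω : α → Matrix D D ℂ} (hω : ∀ a, (ω a).PosSemidef)
    (hσ : ∑ a, ω a = spec V fun i => u (k i)) {M : ℕ} (hM : 0 < M)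
    {s : ℝ} (hs : 0 < s) (hs1 : s ≤ 1) :
    ∃ f : α → Fin M, modMutualInfo (hashState f (blk ω)) ≤
      (Fintype.card o * M) ^ s / s * renyiSum ω s := by
  have : NeZero M := ⟨hM.ne'⟩
  have hN : (Fintype.card (α → Fin M) : ℝ) ≠ 0 := by
    exact_mod_cast Fintype.card_ne_zero
  set N : ℝ := ((Fintype.card (α → Fin M) : ℕ) : ℝ) with hNdef
  set c : ℝ := (M : ℝ)⁻¹ with hcdef
  have hc : 0 < c := by positivity
  have hu' : ∀ i, 0 ≤ u (k i) := fun i => hu _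
  have hσM : ((Fintype.card (Fin M) : ℂ)⁻¹) • ∑ a, ω a = spec V fun i => c * u (k i) := by
    rw [hσ, ← spec_smul, hcdef]; simp
  have avg : ∑ f : α → Fin M, N⁻¹ * modMutualInfo (hashState f (blk ω)) ≤
      (Fintype.card o * M) ^ s / s * renyiSum ω s := by
    refine le_of_forall_pos_le_add fun δ hδ => ?_
    -- Regularizing `log (σ/M)` costs at most `ε / c` per eigenvalue, hence less than `δ` in total;
    -- the `+ 1` also covers dimension zero.
    set ε : ℝ := δ * c / (Fintype.card D + 1) with hεdef
    have hε : 0 < ε := by positivity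
    set κ := spec V fun i => c * u (k i) + ε with hκdef
    have hκ : κ = ((M : ℝ)⁻¹ : ℂ) • ∑ a, ω a + (ε : ℂ) • 1 := by
      rw [← spec_const hV, hκdef, hσ, ← Complex.ofReal_inv, spec_smul, spec_add]
    have h1 (f : α → Fin M) : modMutualInfo (hashState f (blk ω)) ≤
        ∑ a, (ω a * matLog (∑ a' with f a' = f a, ω a' + (ε : ℂ) • 1)).trace.re -
        ∑ i, u (k i) * Real.log (c * u (k i)) := by
      rw [modMutualInfo_hash f hω, hσM, matLog_spec hV, hσ, spec_mul_spec hV, trace_spec hV,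
        Complex.ofReal_re,
        ← sum_bins_trace f ω fun b => matLog (∑ a' with f a' = b, ω a' + (ε : ℂ) • 1)]
      refine sub_le_sub_right (Finset.sum_le_sum fun b _ => ?_) _
      exact trace_mul_log_self_le (posSemidef_sum hω _) hε
    have h2 (a : α) : (ω a * matLog (ω a + κ)).trace.re ≤ (ω a * matLog κ).trace.re +
        (Fintype.card o * M) ^ s / s *
          (matPow (ω a) (1 + s) * matPow (∑ a, ω a) (-s)).trace.re := by
      have hle : (spec V (fun i => u (k i)) - ω a).PosSemidef := by
        rw [← hσ, ← Finset.add_sum_erase _ ω (Finset.mem_univ a), add_sub_cancel_left]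
        exact posSemidef_sum hω _
      have := trace_mul_log_le hV k hu (hω a) hle hc hε hs hs1
      rwa [hcdef, div_inv_eq_mul, ← hσ] at this
    have h3 : ∑ a, (ω a * matLog κ).trace.re - ∑ i, u (k i) * Real.log (c * u (k i)) ≤ δ := by
      rw [← Complex.re_sum, ← trace_sum, ← Matrix.sum_mul, hσ, hκdef, matLog_spec hV,
        spec_mul_spec hV, trace_spec hV, Complex.ofReal_re, ← Finset.sum_sub_distrib]
      have hj (i : D) : u (k i) * Real.log (c * u (k i) + ε) - u (k i) * Real.log (c * u (k i)) ≤
          ε / c := by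
        rcases (hu' i).eq_or_lt with h | h
        · rw [← h]; simp; positivity
        · have hp : 0 < c * u (k i) := by positivity
          rw [← mul_sub, ← Real.log_div (by positivity) hp.ne', add_div, div_self hp.ne']
          have := Real.log_le_sub_one_of_pos (show 0 < 1 + ε / (c * u (k i)) by positivity)
          calc _ ≤ u (k i) * (ε / (c * u (k i))) := by gcongr; linarith
            _ = _ := by field_simp
      refine (Finset.sum_le_sum fun i _ => hj i).trans ?_
      rw [Finset.sum_const, Finset.card_univ, nsmul_eq_mul, hεdef]
      have e : (Fintype.card D : ℝ) * (δ * c / (Fintype.card D + 1) / c) =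
          δ * (Fintype.card D / (Fintype.card D + 1)) := by field_simp
      rw [e]
      refine mul_le_of_le_one_right hδ.le ?_
      rw [div_le_one (by positivity)]
      linarith
    have h4 : ∑ f : α → Fin M, N⁻¹ = 1 := by
      simp [Finset.card_univ, hNdef]
    calc _ ≤ ∑ f : α → Fin M, N⁻¹ *
          (∑ a, (ω a * matLog (∑ a' with f a' = f a, ω a' + (ε : ℂ) • 1)).trace.re -
          ∑ i, u (k i) * Real.log (c * u (k i))) := by
          gcongr with f
          exact h1 f
      _ = ∑ a, ∑ f : α → Fin M, N⁻¹ *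
          (ω a * matLog (∑ a' with f a' = f a, ω a' + (ε : ℂ) • 1)).trace.re -
          ∑ i, u (k i) * Real.log (c * u (k i)) := by
          simp_rw [mul_sub, Finset.sum_sub_distrib, ← Finset.sum_mul, h4, one_mul, Finset.mul_sum]
          rw [Finset.sum_comm]
      _ ≤ ∑ a, ((ω a * matLog κ).trace.re + (Fintype.card o * M) ^ s / s *
          (matPow (ω a) (1 + s) * matPow (∑ a, ω a) (-s)).trace.re) -
          ∑ i, u (k i) * Real.log (c * u (k i)) := by
          gcongr with a
          exact (trace_mul_log_avg_le hω hε hκ a).trans (h2 a)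
      _ ≤ _ := by
          rw [Finset.sum_add_distrib, ← Finset.mul_sum, renyiSum]
          linarith
  have h5 : ∑ f : α → Fin M, N⁻¹ * modMutualInfo (hashState f (blk ω)) ≤
      ∑ f : α → Fin M, N⁻¹ * ((Fintype.card o * M) ^ s / s * renyiSum ω s) := by
    rwa [← Finset.sum_mul, show ∑ f : α → Fin M, N⁻¹ = 1 by simp [Finset.card_univ, hNdef],
      one_mul]
  -- Some function does at least as well as the mean.
  obtain ⟨f, -, hf⟩ := Finset.exists_le_of_sum_le Finset.univ_nonempty h5
  exact ⟨f, le_of_mul_le_mul_left hf (by positivity)⟩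

end OneShot

/-! ### Independent copies, and the Rényi sum as a moment generating function -/

section Iid

variable {α d : Type*} [Fintype α] [DecidableEq α] [Fintype d] [DecidableEq d]

/-- The type (empirical count) of a sequence. -/
def countType {n : ℕ} (x : Fin n → d) (j : d) : Fin (n + 1) :=
  ⟨(Finset.univ.filter fun i => x i = j).card,
    Nat.lt_succ_of_le ((Finset.card_le_univ _).trans_eq (Fintype.card_fin n))⟩

lemma prod_eq_countType {n : ℕ} (t : d → ℝ) (x : Fin n → d) :
    ∏ i, t (x i) = ∏ j, t j ^ (countType x j : ℕ) := by
  rw [← Finset.prod_fiberwise Finset.univ x]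
  refine Finset.prod_congr rfl fun j _ => ?_
  rw [Finset.prod_congr rfl fun i hi => by rw [(Finset.mem_filter.1 hi).2], Finset.prod_const]
  rfl

/-- Privacy amplification for independent copies. -/
theorem exists_hash_iid {ω : α → Matrix d d ℂ} (hω : ∀ a, (ω a).PosSemidef) (n : ℕ) {M : ℕ}
    (hM : 0 < M) {s : ℝ} (hs : 0 < s) (hs1 : s ≤ 1) :
    ∃ f : (Fin n → α) → Fin M, modMutualInfo (hashState f (iidState (blk ω) n)) ≤
      (((n + 1 : ℕ) : ℝ) ^ Fintype.card d * M) ^ s / s * renyiSum ω s ^ n := by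
  obtain ⟨V, hV, t, ht, hσ⟩ := exists_spec_nonneg (posSemidef_sum hω Finset.univ)
  -- The eigenvalues of `σ^{⊗n}` are grouped by type, and there are at most `(n + 1) ^ |d|` types.
  have h := exists_hash_modMutualInfo_le (o := d → Fin (n + 1))
    (piKron_unitary fun _ : Fin n => hV) countType
    (u := fun l => ∏ j, t j ^ (l j : ℕ)) (fun l => Finset.prod_nonneg fun j _ => pow_nonneg (ht j) _)
    (ω := fun a : Fin n → α => piKron fun i => ω (a i)) (fun a => piKron_posSemidef fun i => hω _)
    (by
      rw [sum_piKron, hσ, piKron_spec]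
      simp_rw [prod_eq_countType]) hM hs hs1
  rw [renyiSum_iid hω] at h
  rw [iidState_blk]
  simpa using h

lemma modTraceDist_sq_le {β : Type*} [Fintype β] [DecidableEq β] [Nonempty β] (f : α → β)
    {ω : α → Matrix d d ℂ} (hω : ∀ a, (ω a).PosSemidef) (h1 : (∑ a, ω a).trace = 1) :
    modTraceDist (hashState f (blk ω)) ^ 2 ≤ 4 * modMutualInfo (hashState f (blk ω)) := by
  have hS : ∑ b, ∑ a with f a = b, ω a = ∑ a, ω a := Finset.sum_fiberwise _ _ _
  have hc : (0 : ℂ) ≤ (Fintype.card β : ℂ)⁻¹ := by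
    rw [← Complex.ofReal_natCast, ← Complex.ofReal_inv, Complex.zero_le_real]; positivity
  have hne : (Fintype.card β : ℂ) ≠ 0 := by exact_mod_cast Fintype.card_ne_zero
  rw [modTraceDist, modMutualInfo, hashState_blk, traceA_blk, hS, mixedState_kronecker]
  -- The support condition holds with `C = |β|`: each bin is a partial sum of `σ`, hence at most
  -- `|β| · (σ / |β|)`.
  refine traceNorm_sub_sq_le ⟨blk_posSemidef fun b => posSemidef_sum hω _, ?_⟩
    ⟨blk_posSemidef fun b => (posSemidef_sum hω _).smul hc, ?_⟩ (C := Fintype.card β) ?_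
  · rw [blk_trace, ← trace_sum, hS, h1]
  · simp [blk_trace, trace_smul, h1, hne]
  · rw [blk_smul, blk_sub]
    refine blk_posSemidef fun b => ?_
    rw [Complex.ofReal_natCast, smul_smul, mul_inv_cancel₀ hne, one_smul,
      ← Finset.sum_filter_add_sum_filter_not Finset.univ (fun a => f a = b), add_sub_cancel_left]
    exact posSemidef_sum hω _

lemma modMutualInfo_hash_of_subsingleton (f : α → Fin 1)
    {ω : α → Matrix d d ℂ} (hω : ∀ a, (ω a).PosSemidef) :
    modMutualInfo (hashState f (blk ω)) = 0 := by
  rw [modMutualInfo_hash f hω]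
  have (b : Fin 1) : (Finset.univ.filter fun a => f a = b) = Finset.univ := by
    ext a; simp [Subsingleton.elim (f a) b]
  simp [this]

/-- The sum defining the conditional Rényi entropy is a moment generating function. -/
lemma exists_renyiSum_eq {ω : α → Matrix d d ℂ} (hω : ∀ a, (ω a).PosSemidef)
    (h1 : (∑ a, ω a).trace = 1) :
    ∃ w x : α × d × d → ℝ, (∀ i, 0 ≤ w i) ∧ ∑ i, w i = 1 ∧
      (∀ s : ℝ, 0 ≤ s → renyiSum ω s = ∑ i, w i * Real.exp (s * x i)) ∧
      condEntropy (blk ω) = -∑ i, w i * x i := by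
  obtain ⟨V, hV, t, ht, hσ⟩ := exists_spec_nonneg (posSemidef_sum hω Finset.univ)
  choose U hU r hr hUr using fun a => exists_spec_nonneg (hω a)
  have hz (a : α) (i j : d) (hj : t j = 0) : overlap (U a) V i j * r a i = 0 := by
    refine overlap_mul_eq_zero hV (hr a) (C := 1) ?_ i j hj
    rw [← hUr, ← hσ, Complex.ofReal_one, one_smul,
      ← Finset.add_sum_erase _ ω (Finset.mem_univ a), add_sub_cancel_left]
    exact posSemidef_sum hω _
  have hrow (a : α) (i : d) : ∑ j, overlap (U a) V i j * r a i = r a i := by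
    rw [← Finset.sum_mul, sum_overlap_right (hU a) hV, one_mul]
  -- The joint law of eigenvalue pairs of `ω_a` and `σ`, and their log-likelihood ratio.
  refine ⟨fun p => overlap (U p.1) V p.2.1 p.2.2 * r p.1 p.2.1,
    fun p => Real.log (r p.1 p.2.1) - Real.log (t p.2.2),
    fun p => mul_nonneg (overlap_nonneg ..) (hr _ _), ?_, fun s hs => ?_, ?_⟩
  · simp_rw [Fintype.sum_prod_type, hrow]
    have : ((∑ a, ∑ i, r a i : ℝ) : ℂ) = 1 := by
      rw [← h1, trace_sum, Complex.ofReal_sum]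
      refine Finset.sum_congr rfl fun a _ => ?_
      rw [hUr a, trace_spec (hU a)]
    exact_mod_cast this
  · simp_rw [Fintype.sum_prod_type]
    refine Finset.sum_congr rfl fun a _ => ?_
    rw [hσ, hUr a, matPow_spec (hU a), matPow_spec hV, trace_spec_mul_spec, Complex.ofReal_re,
      Finset.sum_comm]
    refine Finset.sum_congr rfl fun i _ => Finset.sum_congr rfl fun j _ => ?_
    rcases (hr a i).eq_or_lt with h0 | h0
    · rw [← h0, Real.zero_rpow (by linarith)]; simp
    -- On the kernel of `σ` the weight vanishes, so the value of `0 ^ (-s)` is irrelevant, including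
    -- `0 ^ 0 = 1` at `s = 0`.
    rcases (ht j).eq_or_lt with h2 | h2
    · have h3 := hz a i j h2.symm
      rw [h3, zero_mul, (mul_eq_zero.1 h3).resolve_right h0.ne', zero_mul, zero_mul]
    · rw [mul_sub, sub_eq_add_neg, Real.exp_add, mul_comm s (Real.log (r a i)), ← neg_mul,
        mul_comm (-s), ← Real.rpow_def_of_pos h0, ← Real.rpow_def_of_pos h2, Real.rpow_add h0,
        Real.rpow_one]
      ring
  · have e1 : (blk ω * matLog (blk ω)).trace.re = ∑ a, ∑ i, r a i * Real.log (r a i) := by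
      rw [matLog_blk fun a => (hω a).1, blk_mul, blk_trace, Complex.re_sum]
      refine Finset.sum_congr rfl fun a _ => ?_
      rw [hUr a, matLog_spec (hU a), spec_mul_spec (hU a), trace_spec (hU a), Complex.ofReal_re]
    have e2 : ((∑ a, ω a) * matLog (∑ a, ω a)).trace.re =
        ∑ a, ∑ i, ∑ j, overlap (U a) V i j * r a i * Real.log (t j) := by
      rw [Matrix.sum_mul, trace_sum, Complex.re_sum]
      refine Finset.sum_congr rfl fun a _ => ?_
      rw [hσ, hUr a, matLog_spec hV, trace_spec_mul_spec, Complex.ofReal_re, Finset.sum_comm]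
    rw [condEntropy, vonNeumannEntropy, vonNeumannEntropy, traceA_blk, e1, e2]
    simp_rw [Fintype.sum_prod_type, mul_sub, Finset.sum_sub_distrib, ← Finset.sum_mul,
      sum_overlap_right (hU _) hV, one_mul]
    ring

end Iid

/-! ### Exponential rates -/

section Rates

lemma le_decayRate {c b : ℕ → ℝ} {L : ℝ} (hb : ∀ n, 0 < b n) (hcb : ∀ n, c n ≤ b n)
    (hL : Tendsto (fun n : ℕ => -Real.log (b n) / n) atTop (𝓝 L)) :
    (L : EReal) ≤ decayRate c := by
  have h1 : Tendsto (fun n : ℕ => ((-Real.log (b n) / n : ℝ) : EReal)) atTop (𝓝 (L : EReal)) :=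
    (continuous_coe_real_ereal.tendsto L).comp hL
  rw [← h1.liminf_eq, decayRate]
  refine liminf_le_liminf (Eventually.of_forall fun n => ?_)
  have h2 : ENNReal.log (ENNReal.ofReal (c n)) ≤ (Real.log (b n) : EReal) := by
    rw [← ENNReal.log_ofReal_of_pos (hb n)]
    exact ENNReal.log_monotone (ENNReal.ofReal_le_ofReal (hcb n))
  rw [EReal.coe_div, EReal.coe_neg]
  exact EReal.div_le_div_right_of_nonneg (by exact_mod_cast Nat.zero_le n)
    (EReal.neg_le_neg_iff.2 h2)

lemma decayRate_of_nonpos {c : ℕ → ℝ} (hc : ∀ n, c n ≤ 0) : decayRate c = ⊤ := by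
  rw [decayRate]
  refine (Tendsto.congr' ?_ tendsto_const_nhds).liminf_eq
  filter_upwards [eventually_gt_atTop 0] with n hn
  rw [ENNReal.ofReal_of_nonpos (hc n), ENNReal.log_zero, EReal.neg_bot]
  exact (EReal.top_div_of_pos_ne_top (by exact_mod_cast hn) (EReal.natCast_ne_top n)).symm

lemma tendsto_log_nat_ceil_exp_div {R : ℝ} (hR : 0 ≤ R) :
    Tendsto (fun n : ℕ => Real.log (⌈Real.exp (n * R)⌉₊ : ℕ) / n) atTop (𝓝 R) := by
  have hup : Tendsto (fun n : ℕ => Real.log 2 / n + R) atTop (𝓝 R) := by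
    simpa using (tendsto_const_div_atTop_nhds_zero_nat (Real.log 2)).add_const R
  refine tendsto_of_tendsto_of_tendsto_of_le_of_le' tendsto_const_nhds hup ?_ ?_
  all_goals
    filter_upwards [eventually_gt_atTop 0] with n hn
    have hn' : (0 : ℝ) < n := by exact_mod_cast hn
  · rw [le_div_iff₀ hn', Real.le_log_iff_exp_le (by positivity), mul_comm]
    exact Nat.le_ceil _
  · rw [div_add' _ _ _ hn'.ne', div_le_div_iff_of_pos_right hn']
    have h1 : (⌈Real.exp (n * R)⌉₊ : ℝ) ≤ 2 * Real.exp (n * R) := by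
      have h2 := (Nat.ceil_lt_add_one (Real.exp_pos (n * R)).le).le
      have h3 : 1 ≤ Real.exp (n * R) := Real.one_le_exp (by positivity)
      linarith
    calc _ ≤ Real.log (2 * Real.exp (n * R)) := Real.log_le_log (by positivity) h1
      _ = _ := by
        rw [Real.log_mul (by norm_num) (Real.exp_pos _).ne', Real.log_exp, mul_comm R]

lemma tendsto_log_natCast_succ_div :
    Tendsto (fun n : ℕ => Real.log ((n + 1 : ℕ) : ℝ) / n) atTop (𝓝 0) := by
  have h1 : Tendsto (fun n : ℕ => Real.log n / n) atTop (𝓝 0) := by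
    have := (Real.isLittleO_log_id_atTop.tendsto_div_nhds_zero).comp tendsto_natCast_atTop_atTop
    exact this
  have h2 : Tendsto (fun n : ℕ => Real.log 2 / n + Real.log n / n) atTop (𝓝 0) := by
    simpa using (tendsto_const_div_atTop_nhds_zero_nat (Real.log 2)).add h1
  refine tendsto_of_tendsto_of_tendsto_of_le_of_le' tendsto_const_nhds h2
    (Eventually.of_forall fun n => div_nonneg (Real.log_natCast_nonneg _) n.cast_nonneg) ?_
  filter_upwards [eventually_gt_atTop 0] with n hn
  have hn' : (1 : ℝ) ≤ n := by exact_mod_cast hn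
  rw [← add_div, ← Real.log_mul (by norm_num) (by positivity)]
  gcongr
  push_cast; linarith

/-- The polynomial factor and the constant `1/s` disappear on the exponential scale. -/
lemma tendsto_rate {s Φ R : ℝ} (hs : 0 < s) (hΦ : 0 < Φ) (m : ℕ) {M : ℕ → ℕ}
    (hM : ∀ n, 0 < M n) (hMR : Tendsto (fun n : ℕ => Real.log (M n) / n) atTop (𝓝 R)) :
    Tendsto (fun n : ℕ =>
      -Real.log ((((n + 1 : ℕ) : ℝ) ^ m * M n) ^ s / s * Φ ^ n) / n) atTop
      (𝓝 (-Real.log Φ - s * R)) := by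
  have h := (((tendsto_log_natCast_succ_div.const_mul (m : ℝ)).add hMR).const_mul s).neg.add
    (tendsto_const_div_atTop_nhds_zero_nat (Real.log s)) |>.sub_const (Real.log Φ)
  have e : -(s * (m * 0 + R)) + 0 - Real.log Φ = -Real.log Φ - s * R := by ring
  rw [e] at h
  refine h.congr' ?_
  filter_upwards [eventually_gt_atTop 0] with n hn
  have hn' : (0 : ℝ) < n := by exact_mod_cast hn
  have hMn : (0 : ℝ) < M n := by exact_mod_cast hM n
  rw [Real.log_mul (by positivity) (by positivity), Real.log_div (by positivity) hs.ne',
    Real.log_rpow (by positivity), Real.log_mul (by positivity) hMn.ne', Real.log_pow, Real.log_pow]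
  field_simp
  ring

end Rates

/-! ### Lower bounds on the exponents for a fixed `s` -/

section Exponents

variable {α d : Type*} [Fintype α] [DecidableEq α] [Fintype d] [DecidableEq d]

lemma sum_iid_trace {ω : α → Matrix d d ℂ} (h1 : (∑ a, ω a).trace = 1) (n : ℕ) :
    (∑ a : Fin n → α, piKron fun i => ω (a i)).trace = 1 := by
  rw [sum_piKron, piKron_trace, h1, Finset.prod_const_one]

/-- At a negative rate the constant hash `M_n = 1` is admissible and perfectly secure. -/
lemma exponents_eq_top {ω : α → Matrix d d ℂ} (hω : ∀ a, (ω a).PosSemidef)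
    (h1 : (∑ a, ω a).trace = 1) {R : ℝ} (hR : R < 0) :
    exponentI (blk ω) R = ⊤ ∧ exponentD (blk ω) R = ⊤ := by
  have hlim : Tendsto (fun n : ℕ => Real.log ((1 : ℕ) : ℝ) / n) atTop (𝓝 0) := by simp
  have hI (n : ℕ) : modMutualInfo (hashState (fun _ : Fin n → α => (0 : Fin 1))
      (iidState (blk ω) n)) = 0 := by
    rw [iidState_blk]
    exact modMutualInfo_hash_of_subsingleton _ fun a => piKron_posSemidef fun i => hω _
  have hD (n : ℕ) : modTraceDist (hashState (fun _ : Fin n → α => (0 : Fin 1))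
      (iidState (blk ω) n)) = 0 := by
    have h := modTraceDist_sq_le (fun _ : Fin n → α => (0 : Fin 1))
      (fun a => piKron_posSemidef fun i => hω (a i)) (sum_iid_trace h1 n)
    rw [← iidState_blk, hI, mul_zero] at h
    exact pow_eq_zero_iff two_ne_zero |>.1 (le_antisymm h (sq_nonneg _))
  constructor
  · refine top_le_iff.1 (le_sSup ⟨fun _ => 1, fun _ _ => 0, 0, hlim, hR.le, ?_⟩)
    exact (decayRate_of_nonpos fun n => (hI n).le).symm
  · refine top_le_iff.1 (le_sSup ⟨fun _ => 1, fun _ _ => 0, 0, hlim, hR.le, ?_⟩)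
    exact (decayRate_of_nonpos fun n => (hD n).le).symm

lemma le_exponents {ω : α → Matrix d d ℂ} (hω : ∀ a, (ω a).PosSemidef)
    (h1 : (∑ a, ω a).trace = 1) {R s : ℝ} (hs : 0 < s) (hs1 : s ≤ 1) (hΦ : 0 < renyiSum ω s) :
    ((-Real.log (renyiSum ω s) - s * R : ℝ) : EReal) ≤ exponentI (blk ω) R ∧
    (((-Real.log (renyiSum ω s) - s * R) / 2 : ℝ) : EReal) ≤ exponentD (blk ω) R := by
  -- Negative rates are separate: since `M_n ≥ 1`, `log M_n / n` cannot converge to `R < 0`.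
  rcases lt_or_ge R 0 with hR | hR
  · obtain ⟨hI, hD⟩ := exponents_eq_top hω h1 hR
    rw [hI, hD]
    exact ⟨le_top, le_top⟩
  set M : ℕ → ℕ := fun n => ⌈Real.exp (n * R)⌉₊ with hMdef
  have hM (n : ℕ) : 0 < M n := Nat.ceil_pos.2 (Real.exp_pos _)
  choose f hf using fun n => exists_hash_iid hω n (hM n) hs hs1
  set b : ℕ → ℝ := fun n =>
    (((n + 1 : ℕ) : ℝ) ^ Fintype.card d * M n) ^ s / s * renyiSum ω s ^ n with hbdef
  have hb (n : ℕ) : 0 < b n := by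
    have : (0 : ℝ) < M n := by exact_mod_cast hM n
    positivity
  have hMR := tendsto_log_nat_ceil_exp_div hR
  have hrate := tendsto_rate hs hΦ (Fintype.card d) hM hMR
  constructor
  · refine le_trans (le_decayRate hb hf hrate) ?_
    exact le_sSup ⟨M, f, R, hMR, le_rfl, rfl⟩
  · have hD (n : ℕ) : modTraceDist (hashState (f n) (iidState (blk ω) n)) ≤ 2 * √(b n) := by
      have : Nonempty (Fin (M n)) := ⟨⟨0, hM n⟩⟩
      have h := modTraceDist_sq_le (f n)
        (fun a => piKron_posSemidef fun i => hω (a i)) (sum_iid_trace h1 n)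
      rw [← iidState_blk] at h
      have h4 : √(4 * b n) = 2 * √(b n) := by
        rw [Real.sqrt_mul (by norm_num), show (4 : ℝ) = 2 ^ 2 by norm_num,
          Real.sqrt_sq (by norm_num)]
      rw [← h4]
      exact Real.le_sqrt_of_sq_le (h.trans (mul_le_mul_of_nonneg_left (hf n) (by norm_num)))
    refine le_trans (le_decayRate (fun n => ?_) hD (L := (-Real.log (renyiSum ω s) - s * R) / 2)
      ?_) (le_sSup ⟨M, f, R, hMR, le_rfl, rfl⟩)
    · have := Real.sqrt_pos.2 (hb n)
      positivity
    · have h := (hrate.div_const 2).sub (tendsto_const_div_atTop_nhds_zero_nat (Real.log 2))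
      rw [sub_zero] at h
      refine h.congr fun n => ?_
      rw [Real.log_mul (by norm_num) (Real.sqrt_pos.2 (hb n)).ne', Real.log_sqrt (hb n).le]
      ring

end Exponents

end PrivacyAmp

end

/-! ### The maximum over `s` and its positivity below the conditional entropy -/

theorem mainTheorem5 {A d : Type*} [Fintype A] [DecidableEq A] [Fintype d] [DecidableEq d]
    (P : A → ℝ) (hP : ∀ a, 0 ≤ P a) (hP1 : ∑ a, P a = 1)
    (τ : A → Matrix d d ℂ) (hτ : ∀ a, PrivacyAmp.IsDensity (τ a)) (R : ℝ) :
    IsGreatest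
      ((fun s : ℝ => s * (PrivacyAmp.condRenyi s (PrivacyAmp.cqState P τ) - R)) '' Set.Icc 0 1)
      (PrivacyAmp.exponentH (PrivacyAmp.cqState P τ) R) ∧
    (PrivacyAmp.exponentH (PrivacyAmp.cqState P τ) R : EReal) ≤
      PrivacyAmp.exponentI (PrivacyAmp.cqState P τ) R ∧
    ((PrivacyAmp.exponentH (PrivacyAmp.cqState P τ) R / 2 : ℝ) : EReal) ≤
      PrivacyAmp.exponentD (PrivacyAmp.cqState P τ) R ∧
    (R < PrivacyAmp.condEntropy (PrivacyAmp.cqState P τ) →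
      0 < PrivacyAmp.exponentH (PrivacyAmp.cqState P τ) R ∧
      0 < PrivacyAmp.exponentI (PrivacyAmp.cqState P τ) R ∧
      0 < PrivacyAmp.exponentD (PrivacyAmp.cqState P τ) R) := by
  set ω : A → Matrix d d ℂ := fun a => (P a : ℂ) • τ a with hωdef
  have hω (a : A) : (ω a).PosSemidef := (hτ a).1.smul (Complex.zero_le_real.2 (hP a))
  have h1 : (∑ a, ω a).trace = 1 := by
    simp only [hωdef, Matrix.trace_sum, Matrix.trace_smul, fun a => (hτ a).2, smul_eq_mul, mul_one]
    exact_mod_cast hP1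
  rw [show PrivacyAmp.cqState P τ = PrivacyAmp.blk ω from PrivacyAmp.cqState_eq_blk P τ]
  obtain ⟨w, x, hw, hw1, hmgf, hH⟩ := PrivacyAmp.exists_renyiSum_eq hω h1
  set Ψ : ℝ → ℝ := fun s => ∑ i, w i * Real.exp (s * x i) with hΨ
  set h : ℝ → ℝ := fun s => -Real.log (Ψ s) - s * R with hh
  have hΨ0 : Ψ 0 = 1 := by simp [hΨ, hw1]
  have hΨpos (s : ℝ) : 0 < Ψ s := by
    have hnn : ∀ i ∈ Finset.univ, 0 ≤ w i * Real.exp (s * x i) := fun i _ =>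
      mul_nonneg (hw i) (Real.exp_pos _).le
    refine lt_of_le_of_ne (Finset.sum_nonneg hnn) fun h0 => ?_
    have hz := (Finset.sum_eq_zero_iff_of_nonneg hnn).1 h0.symm
    have : ∑ i, w i = 0 := Finset.sum_eq_zero fun i hi =>
      (mul_eq_zero.1 (hz i hi)).resolve_right (Real.exp_pos _).ne'
    linarith
  -- At `s = 0` the factor `s` hides the division by zero in `condRenyi`, and `h 0 = 0` because the
  -- weights sum to `1`.
  have hgh (s : ℝ) (hs : 0 ≤ s) : s * (PrivacyAmp.condRenyi s (PrivacyAmp.blk ω) - R) = h s := by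
    rcases hs.eq_or_lt with rfl | hs'
    · simp [hh, hΨ0]
    · rw [PrivacyAmp.condRenyi_blk hω, hmgf s hs, hh]
      field_simp
      rfl
  have hder (s : ℝ) : HasDerivAt Ψ (∑ i, w i * (Real.exp (s * x i) * x i)) s := by
    refine HasDerivAt.fun_sum fun i _ => HasDerivAt.const_mul _ ?_
    simpa using ((hasDerivAt_id s).mul_const (x i)).exp
  have hderh (s : ℝ) := ((hder s).log (hΨpos s).ne').neg.sub ((hasDerivAt_id s).mul_const R)
  have hcont : Continuous h := continuous_iff_continuousAt.2 fun s => (hderh s).continuousAt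
  have hh0 : h 0 = 0 := by simp [hh, hΨ0]
  have hgreat : IsGreatest
      ((fun s : ℝ => s * (PrivacyAmp.condRenyi s (PrivacyAmp.blk ω) - R)) '' Set.Icc 0 1)
      (PrivacyAmp.exponentH (PrivacyAmp.blk ω) R) := by
    rw [PrivacyAmp.exponentH, Set.image_congr fun s hs => hgh s hs.1]
    exact (isCompact_Icc.image hcont).isGreatest_sSup ((Set.nonempty_Icc.2 zero_le_one).image h)
  have hIoc (s : ℝ) (hs : 0 < s) (hs1 : s ≤ 1) :
      (h s : EReal) ≤ PrivacyAmp.exponentI (PrivacyAmp.blk ω) R ∧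
      ((h s / 2 : ℝ) : EReal) ≤ PrivacyAmp.exponentD (PrivacyAmp.blk ω) R := by
    have := PrivacyAmp.le_exponents hω h1 (R := R) hs hs1 (by rw [hmgf s hs.le]; exact hΨpos s)
    rwa [hmgf s hs.le] at this
  have hmem : Set.Ioc (0 : ℝ) 1 ∈ 𝓝[>] (0 : ℝ) := Ioc_mem_nhdsGT zero_lt_one
  have hIcc (s : ℝ) (hs : 0 ≤ s) (hs1 : s ≤ 1) :
      (h s : EReal) ≤ PrivacyAmp.exponentI (PrivacyAmp.blk ω) R ∧
      ((h s / 2 : ℝ) : EReal) ≤ PrivacyAmp.exponentD (PrivacyAmp.blk ω) R := by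
    rcases hs.eq_or_lt with rfl | hs'
    -- The hashing bound contains `1/s`, so `s = 0` is reached as a limit from the right.
    · have hc1 : Tendsto (fun s => (h s : EReal)) (𝓝[>] 0) (𝓝 (h 0 : EReal)) :=
        ((continuous_coe_real_ereal.comp hcont).tendsto 0).mono_left nhdsWithin_le_nhds
      have hc2 : Tendsto (fun s => ((h s / 2 : ℝ) : EReal)) (𝓝[>] 0) (𝓝 ((h 0 / 2 : ℝ) : EReal)) :=
        ((continuous_coe_real_ereal.comp (hcont.div_const 2)).tendsto 0).mono_left
          nhdsWithin_le_nhds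
      constructor
      · refine le_of_tendsto hc1 ?_
        filter_upwards [hmem] with s hs
        exact (hIoc s hs.1 hs.2).1
      · refine le_of_tendsto hc2 ?_
        filter_upwards [hmem] with s hs
        exact (hIoc s hs.1 hs.2).2
    · exact hIoc s hs' hs1
  have hID : (PrivacyAmp.exponentH (PrivacyAmp.blk ω) R : EReal) ≤
        PrivacyAmp.exponentI (PrivacyAmp.blk ω) R ∧
      ((PrivacyAmp.exponentH (PrivacyAmp.blk ω) R / 2 : ℝ) : EReal) ≤
        PrivacyAmp.exponentD (PrivacyAmp.blk ω) R := by
    obtain ⟨s, hs, hse⟩ := hgreat.1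
    rw [← hse]
    simp only [hgh s hs.1]
    exact hIcc s hs.1 hs.2
  refine ⟨hgreat, hID.1, hID.2, fun hR => ?_⟩
  have hpos : 0 < PrivacyAmp.exponentH (PrivacyAmp.blk ω) R := by
    -- As `h 0 = 0`, a positive derivative at `0` forces `h s > 0` for some small `s > 0`.
    have hd : HasDerivAt h (PrivacyAmp.condEntropy (PrivacyAmp.blk ω) - R) 0 := by
      refine (hderh 0).congr_deriv ?_
      simp [hΨ0, hH]
    have hsl := (hasDerivAt_iff_tendsto_slope.1 hd).eventually
      (lt_mem_nhds (show 0 < PrivacyAmp.condEntropy (PrivacyAmp.blk ω) - R by linarith))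
    have hsl' := hsl.filter_mono
      (show 𝓝[>] (0 : ℝ) ≤ 𝓝[≠] 0 from nhdsWithin_mono _ fun s (hs : 0 < s) => hs.ne')
    obtain ⟨s, hs, hs01⟩ := (hsl'.and hmem).exists
    rw [slope_def_field, hh0, sub_zero, sub_zero] at hs
    have hspos : 0 < h s := by
      have := mul_pos hs hs01.1
      rwa [div_mul_cancel₀ _ hs01.1.ne'] at this
    exact hspos.trans_le (hgreat.2 ⟨s, ⟨hs01.1.le, hs01.2⟩, hgh s hs01.1.le⟩)
  refine ⟨hpos, lt_of_lt_of_le ?_ hID.1, lt_of_lt_of_le ?_ hID.2⟩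
  · exact_mod_cast hpos
  · exact_mod_cast half_pos hpos
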